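/- Let $p$ be a prime, $k$ a perfect field of characteristic $p$, and $K$ a finite extension of $W(k)[1/p]$ (for instance a finite extension of $\mathbf{Q}_p$), with its $p$-adic absolute value, ring of integers $\mathcal{O}_K$ and maximal ideal $\mathfrak{m}_K$. Let $\mathbf{C}_p$ be the completion of an algebraic closure of $K$ and let $\mathfrak{m}_{\mathbf{C}_p} = \{z \in \mathbf{C}_p : |z| < 1\}$. Let $F(X,Y) \in \mathcal{O}_K[[X,Y]]$ be a one-dimensional formal group law over $\mathcal{O}_K$. For $n \geq 0$ let $[n](X) \in \mathcal{O}_K[[X]]$ be its multiplication-by-$n$ series, and let $\operatorname{Tors}(F)$ be the set of $z \in \mathfrak{m}_{\mathbf{C}_p}$ such that $[n](z) = 0$ for some $n \geq 1$. Let $\mathrm{Log}_F \in K[[X]]$ be the logarithm of $F$, that is, the power series with $\mathrm{Log}_F(0)=0$ and $\mathrm{Log}_F'(X) = \big(\tfrac{\partial F}{\partial X}(0,X)\big)^{-1}$, so that $\mathrm{d}\,\mathrm{Log}_F$ is the normalized invariant differential of $F$. Assume that $F$ is of finite height, i.e. $[p](X) \not\equiv 0 \bmod \mathfrak{m}_K$.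 Then $\mathrm{Log}_F$ is the unique power series $f$ with the following properties: 1. $f \in X + X^2 \cdot K[[X]]$; 2. $f$ is holomorphic on $\mathfrak{m}_{\mathbf{C}_p}$, i.e. the series $f(z)$ converges for all $z \in \mathfrak{m}_{\mathbf{C}_p}$; 3. the set of zeros of $f$ in $\mathfrak{m}_{\mathbf{C}_p}$ is exactly $\operatorname{Tors}(F)$, and each of these zeros has multiplicity $1$; 4. the derivative $f'$ is bounded on $\mathfrak{m}_{\mathbf{C}_p}$. -/

import Mathlib

noncomputable section

namespace FGLog

section Fields

variable (K : Type*) [NontriviallyNormedField K] [IsUltrametricDist K]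

/-- The ring of integers `𝒪_K = {x ∈ K : ‖x‖ ≤ 1}`; it is a local ring with maximal ideal
`{x : ‖x‖ < 1}`. -/
abbrev Integers : ValuationSubring K := (NormedField.valuation (K := K)).valuationSubring

/-- An algebraic closure of `K`, to be normed by the unique extension of the norm of `K`. -/
def AlgCl (K : Type*) [Field K] : Type _ := AlgebraicClosure K

instance [CompleteSpace K] : NormedField (AlgCl K) :=
  spectralNorm.normedField K (AlgebraicClosure K)

/-- The completion of the algebraic closure of `K`. -/
abbrev Cp [CompleteSpace K] : Type _ := UniformSpace.Completion (AlgCl K)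

/-- The embedding of `K` into the completion of its algebraic closure. -/
def toCp [CompleteSpace K] : K →+* Cp K :=
  (UniformSpace.Completion.coeRingHom (α := AlgCl K)).comp
    (algebraMap K (AlgebraicClosure K) : K →+* AlgebraicClosure K)

end Fields

section Series

variable {K : Type*} [NontriviallyNormedField K] [IsUltrametricDist K] [CompleteSpace K]

/-- The value at `z` of a power series with coefficients in `K`. -/
def eval (f : PowerSeries K) (z : Cp K) : Cp K :=
  ∑' n : ℕ, toCp K (PowerSeries.coeff n f) * z ^ n

/-- `f` is holomorphic on the open unit disk: it converges at each of its points. -/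
def HolomorphicOnDisk (f : PowerSeries K) : Prop :=
  ∀ z : Cp K, ‖z‖ < 1 → Summable fun n : ℕ => toCp K (PowerSeries.coeff n f) * z ^ n

/-- The zeros of `f` in the open unit disk. -/
def zeroSet (f : PowerSeries K) : Set (Cp K) :=
  {z | ‖z‖ < 1 ∧ eval f z = 0}

/-- `z` is a zero of `f` of multiplicity one. -/
def IsSimpleZero (f : PowerSeries K) (z : Cp K) : Prop :=
  eval f z = 0 ∧ eval (PowerSeries.derivative K f) z ≠ 0

/-- `f` is bounded on the open unit disk. -/
def BoundedOnDisk (f : PowerSeries K) : Prop :=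
  ∃ M : ℝ, ∀ z : Cp K, ‖z‖ < 1 → ‖eval f z‖ ≤ M

end Series

section FormalGroups

/-- The multiplication by `n` series `[n](X)` of a formal group:
`[0](X) = 0` and `[n + 1](X) = F([n](X), X)`. -/
def mulSeries {R : Type*} [CommRing R] (F : FormalGroup R) : ℕ → PowerSeries R
  | 0 => 0
  | n + 1 => MvPowerSeries.subst ![mulSeries F n, PowerSeries.X] F.toPowerSeries

/-- The series `ω(X)` such that `ω(X) dX` is the normalized invariant differential of `F`:
the inverse of `(∂F/∂X)(0, X)`, whose constant term is `1`. -/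
def invDiff {R : Type*} [CommRing R] (F : FormalGroup R) : PowerSeries R :=
  PowerSeries.invOfUnit
    (MvPowerSeries.subst ![(0 : PowerSeries R), PowerSeries.X]
      (MvPowerSeries.pderiv R (0 : Fin 2) F.toPowerSeries) : PowerSeries R) 1

variable {K : Type*} [NontriviallyNormedField K] [IsUltrametricDist K]

/-- The logarithm of `F`: the series without constant term whose differential is the normalized
invariant differential of `F`. -/
def Log (F : FormalGroup (Integers K)) : PowerSeries K :=
  PowerSeries.mk fun n =>
    match n with
    | 0 => 0
    | n + 1 => algebraMap (Integers K) K (PowerSeries.coeff n (invDiff F)) / ((n : K) + 1)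

/-- `F` has finite height: `[p](X)` does not vanish modulo the maximal ideal of `𝒪_K`. -/
def FiniteHeight (p : ℕ) (F : FormalGroup (Integers K)) : Prop :=
  PowerSeries.map (IsLocalRing.residue (Integers K)) (mulSeries F p) ≠ 0

/-- The torsion points of `F` in the open unit disk. -/
def Tors [CompleteSpace K] (F : FormalGroup (Integers K)) : Set (Cp K) :=
  {z | ‖z‖ < 1 ∧
    ∃ n : ℕ, 0 < n ∧ eval (PowerSeries.map (algebraMap (Integers K) K) (mulSeries F n)) z = 0}

end FormalGroups

end FGLog

end

open scoped PowerSeries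

namespace FGLog

/-! The logarithm linearises the group: `Log([n](z)) = n Log(z)`, from the invariance of the
differential. Hence torsion points are zeros. Conversely `[p](X) = pX + ⋯` is integral, so iterating
it contracts a zero `z` of `Log` towards `0`; some `[p^k](z)` lies in a disk where `Log` has no zero
but `0`, and it is itself a zero (`ev_log_eq_zero_iff`). The derivative of `Log` is integral with
constant term `1`, so it has norm `1` on the whole disk: the zeros are simple and the derivative is
bounded.

For uniqueness write `f = Log · u` with `u(0) = 1`. On each smaller disk, after rescaling over a
finite extension of `K`, Weierstrass preparation turns `f` and `Log` into a constant times a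
distinguished polynomial times a unit. Equal simple zeros give equal polynomials, so `u` has
integral coefficients (`integral_of_zeroSet_eq`). Now `f' = Log · u' + u · Log'`, so `Log · u'` is
bounded. If `u' ≠ 0`, then `|u'(z)| = |s| |z|^d` near the boundary, with `s ≠ 0`, and `Log` would
have bounded coefficients (`exists_bound_of_mul_bound`). Finite height forbids this
(`not_bounded_log`): scale `Log` to an integral `ℓ` that is nonzero modulo the maximal ideal;
reducing `ℓ ∘ [p] = pℓ` gives a vanishing composite of two nonzero series over a field. So `u' = 0`
and `u = 1`. -/

theorem summable_prod_mul_of_nonneg {a b : ℕ → ℝ} (ha : Summable a) (hb : Summable b)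
    (ha0 : ∀ n, 0 ≤ a n) (hb0 : ∀ n, 0 ≤ b n) : Summable fun q : ℕ × ℕ => a q.1 * b q.2 :=
  ha.mul_of_nonneg hb ha0 hb0

theorem summable_sum_antidiagonal_of_nonneg {a b : ℕ → ℝ} (ha : Summable a) (hb : Summable b)
    (ha0 : ∀ n, 0 ≤ a n) (hb0 : ∀ n, 0 ≤ b n) :
    Summable fun n => ∑ q ∈ Finset.HasAntidiagonal.antidiagonal n, a q.1 * b q.2 :=
  summable_sum_mul_antidiagonal_of_summable_mul (f := a) (g := b)
    (summable_prod_mul_of_nonneg ha hb ha0 hb0)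

/-! ### Evaluation of power series on the open unit disk. -/

section Evaluation

variable {C : Type*} [NormedField C]

/-- The value at `z` of a power series. -/
noncomputable def ev (f : C⟦X⟧) (z : C) : C := ∑' n : ℕ, PowerSeries.coeff n f * z ^ n

/-- The power series converges absolutely on each disk of radius less than one. -/
def ConvOnDisk (f : C⟦X⟧) : Prop :=
  ∀ r : ℝ, 0 ≤ r → r < 1 → Summable fun n : ℕ => ‖PowerSeries.coeff n f‖ * r ^ n

/-- The coefficients of the power series lie in the closed unit ball. -/
def Integral (f : C⟦X⟧) : Prop := ∀ n, ‖PowerSeries.coeff n f‖ ≤ 1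

/-- Bounded terms at a radius `s` strictly between `r` and `1` are dominated at `r` by a geometric
series of ratio `r / s`. -/
theorem convOnDisk_of_bounded {f : C⟦X⟧}
    (h : ∀ r : ℝ, 0 < r → r < 1 → ∃ M, ∀ n, ‖PowerSeries.coeff n f‖ * r ^ n ≤ M) :
    ConvOnDisk f := by
  intro r hr hr1
  obtain ⟨s, hs, hs1⟩ := exists_between hr1
  have hs0 : 0 < s := hr.trans_lt hs
  obtain ⟨M, hM⟩ := h s hs0 hs1
  refine Summable.of_nonneg_of_le (fun n => by positivity) (fun n => ?_)
    ((summable_geometric_of_lt_one (r := r / s) (by positivity) ((div_lt_one hs0).2 hs)).mul_left M)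
  calc ‖PowerSeries.coeff n f‖ * r ^ n
      = (‖PowerSeries.coeff n f‖ * s ^ n) * (r / s) ^ n := by
        rw [div_pow]; field_simp
    _ ≤ M * (r / s) ^ n := by gcongr; exact hM n

theorem convOnDisk_of_coeff_le {f : C⟦X⟧} {M : ℝ} (h : ∀ n, ‖PowerSeries.coeff n f‖ ≤ M) :
    ConvOnDisk f := by
  refine convOnDisk_of_bounded fun r hr hr1 => ⟨M, fun n => ?_⟩
  calc ‖PowerSeries.coeff n f‖ * r ^ n ≤ ‖PowerSeries.coeff n f‖ * 1 := by
        gcongr; exact pow_le_one₀ hr.le hr1.le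
    _ ≤ M := by simpa using h n

theorem Integral.convOnDisk {f : C⟦X⟧} (h : Integral f) : ConvOnDisk f := convOnDisk_of_coeff_le h

theorem ConvOnDisk.summable_norm {f : C⟦X⟧} (hf : ConvOnDisk f) {z : C} (hz : ‖z‖ < 1) :
    Summable fun n : ℕ => ‖PowerSeries.coeff n f * z ^ n‖ := by
  simpa [norm_mul, norm_pow] using hf ‖z‖ (norm_nonneg z) hz

theorem ConvOnDisk.summable [CompleteSpace C] {f : C⟦X⟧} (hf : ConvOnDisk f) {z : C}
    (hz : ‖z‖ < 1) : Summable fun n : ℕ => PowerSeries.coeff n f * z ^ n :=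
  (hf.summable_norm hz).of_norm

theorem ConvOnDisk.add {f g : C⟦X⟧} (hf : ConvOnDisk f) (hg : ConvOnDisk g) :
    ConvOnDisk (f + g) := by
  intro r hr hr1
  refine Summable.of_nonneg_of_le (fun n => by positivity) (fun n => ?_)
    ((hf r hr hr1).add (hg r hr hr1))
  rw [map_add, ← add_mul]
  gcongr
  exact norm_add_le _ _

theorem ConvOnDisk.mul {f g : C⟦X⟧} (hf : ConvOnDisk f) (hg : ConvOnDisk g) :
    ConvOnDisk (f * g) := by
  intro r hr hr1
  have := summable_sum_antidiagonal_of_nonneg (hf r hr hr1) (hg r hr hr1)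
    (fun n => mul_nonneg (norm_nonneg _) (pow_nonneg hr n))
    (fun n => mul_nonneg (norm_nonneg _) (pow_nonneg hr n))
  refine Summable.of_nonneg_of_le (fun n => by positivity) (fun n => ?_) this
  rw [PowerSeries.coeff_mul]
  calc _ ≤ (∑ p ∈ Finset.HasAntidiagonal.antidiagonal n,
          ‖PowerSeries.coeff p.1 f * PowerSeries.coeff p.2 g‖) * r ^ n := by
        gcongr; exact norm_sum_le _ _
    _ = _ := by
        rw [Finset.sum_mul]
        refine Finset.sum_congr rfl fun p hp => ?_
        rw [← Finset.HasAntidiagonal.mem_antidiagonal.1 hp, norm_mul, pow_add]; ring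

theorem ev_add [CompleteSpace C] {f g : C⟦X⟧} (hf : ConvOnDisk f) (hg : ConvOnDisk g) {z : C}
    (hz : ‖z‖ < 1) : ev (f + g) z = ev f z + ev g z := by
  simp only [ev, map_add, add_mul]
  exact (hf.summable hz).tsum_add (hg.summable hz)

theorem ev_mul [CompleteSpace C] {f g : C⟦X⟧} (hf : ConvOnDisk f) (hg : ConvOnDisk g) {z : C}
    (hz : ‖z‖ < 1) : ev (f * g) z = ev f z * ev g z := by
  rw [ev, ev, ev, tsum_mul_tsum_eq_tsum_sum_antidiagonal_of_summable_norm
    (hf.summable_norm hz) (hg.summable_norm hz)]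
  refine tsum_congr fun n => ?_
  rw [PowerSeries.coeff_mul, Finset.sum_mul]
  refine Finset.sum_congr rfl fun p hp => ?_
  rw [← Finset.HasAntidiagonal.mem_antidiagonal.1 hp, pow_add]; ring

theorem ev_coe (P : Polynomial C) (z : C) : ev (P : C⟦X⟧) z = P.eval z := by
  rw [ev, tsum_eq_sum (s := Finset.range (P.natDegree + 1)), Polynomial.eval_eq_sum_range]
  · simp
  · intro n hn
    rw [Polynomial.coeff_coe, Polynomial.coeff_eq_zero_of_natDegree_lt, zero_mul]
    simpa [Nat.lt_succ_iff] using hn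

theorem convOnDisk_coe (P : Polynomial C) : ConvOnDisk (P : C⟦X⟧) := fun r _ _ =>
  summable_of_ne_finset_zero (s := Finset.range (P.natDegree + 1)) fun n hn => by
    rw [Polynomial.coeff_coe, Polynomial.coeff_eq_zero_of_natDegree_lt, norm_zero, zero_mul]
    simpa [Nat.lt_succ_iff] using hn

theorem ev_C (c z : C) : ev (PowerSeries.C c) z = c := by
  simpa using ev_coe (Polynomial.C c) z

theorem ev_one (z : C) : ev (1 : C⟦X⟧) z = 1 := by
  simpa using ev_C 1 z

theorem convOnDisk_C (c : C) : ConvOnDisk (PowerSeries.C c) :=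
  convOnDisk_of_coeff_le (M := ‖c‖) fun n => by
    rw [PowerSeries.coeff_C]; split_ifs <;> simp

theorem ev_C_mul [CompleteSpace C] (c : C) {f : C⟦X⟧} (hf : ConvOnDisk f) {z : C} (hz : ‖z‖ < 1) :
    ev (PowerSeries.C c * f) z = c * ev f z := by
  rw [ev_mul (convOnDisk_C c) hf hz, ev_C]

theorem ev_rescale (a : C) (f : C⟦X⟧) (z : C) :
    ev (PowerSeries.rescale a f) z = ev f (a * z) := by
  simp only [ev, PowerSeries.coeff_rescale, mul_pow]
  exact tsum_congr fun n => by ring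

theorem ev_zero_right (f : C⟦X⟧) : ev f 0 = PowerSeries.constantCoeff f := by
  rw [ev, tsum_eq_single 0]
  · simp
  · intro n hn; simp [hn]

/-- The factor `n` created by differentiation is absorbed by `(r / s) ^ n` for a radius `s` between
`r` and `1`. -/
theorem ConvOnDisk.derivative {f : C⟦X⟧} (hf : ConvOnDisk f) :
    ConvOnDisk (PowerSeries.derivative C f) := by
  intro r hr hr1
  obtain ⟨s, hs, hs1⟩ := exists_between hr1
  have hs0 : 0 < s := hr.trans_lt hs
  have h1 := hf s hs0.le hs1
  obtain ⟨M, hM⟩ := (tendsto_self_mul_const_pow_of_lt_one (r := r / s) (by positivity)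
    ((div_lt_one hs0).2 hs)).bddAbove_range
  have h2 := ((summable_nat_add_iff 1).2 h1).mul_left ((M + 1) / s)
  refine Summable.of_nonneg_of_le (fun n => by positivity) (fun n => ?_) h2
  have hMn : (n : ℝ) * (r / s) ^ n ≤ M := hM ⟨n, rfl⟩
  have hn1 : ‖(n : C) + 1‖ ≤ n + 1 := by
    simpa using Nat.norm_cast_le (α := C) (n + 1)
  have hrs : (r / s) ^ n ≤ 1 := pow_le_one₀ (by positivity) ((div_le_one hs0).2 hs.le)
  rw [PowerSeries.coeff_derivative, norm_mul]
  calc ‖PowerSeries.coeff (n + 1) f‖ * ‖(n : C) + 1‖ * r ^ n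
      ≤ ‖PowerSeries.coeff (n + 1) f‖ * (n + 1) * r ^ n := by gcongr
    _ = ‖PowerSeries.coeff (n + 1) f‖ * s ^ n * (n * (r / s) ^ n + (r / s) ^ n) := by
        rw [div_pow]; field_simp
    _ ≤ ‖PowerSeries.coeff (n + 1) f‖ * s ^ n * (M + 1) := by gcongr
    _ = _ := by rw [pow_succ]; field_simp

theorem integral_one : Integral (1 : C⟦X⟧) := fun n => by
  rw [PowerSeries.coeff_one]; split_ifs <;> simp

section Integral

variable [IsUltrametricDist C]

theorem Integral.mul {f g : C⟦X⟧} (hf : Integral f) (hg : Integral g) : Integral (f * g) := by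
  intro n
  rw [PowerSeries.coeff_mul]
  refine IsUltrametricDist.norm_sum_le_of_forall_le_of_nonneg zero_le_one fun p _ => ?_
  rw [norm_mul]
  exact mul_le_one₀ (hf _) (norm_nonneg _) (hg _)

theorem Integral.pow {f : C⟦X⟧} (hf : Integral f) (n : ℕ) : Integral (f ^ n) := by
  induction n with
  | zero => rw [pow_zero]; exact integral_one
  | succ n ih => rw [pow_succ]; exact ih.mul hf

theorem norm_ev_le {f : C⟦X⟧} {M : ℝ} {z : C}
    (h : ∀ n, ‖PowerSeries.coeff n f‖ * ‖z‖ ^ n ≤ M) : ‖ev f z‖ ≤ M :=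
  IsUltrametricDist.norm_tsum_le_of_forall_le fun n => by simpa using h n

theorem norm_ev_le_of_coeff_le {f : C⟦X⟧} {M : ℝ} (h : ∀ n, ‖PowerSeries.coeff n f‖ ≤ M) {z : C}
    (hz : ‖z‖ ≤ 1) : ‖ev f z‖ ≤ M :=
  norm_ev_le fun n => (mul_le_of_le_one_right (norm_nonneg _)
    (pow_le_one₀ (norm_nonneg z) hz)).trans (h n)

/-- An integral power series without constant term maps the open unit disk to itself. -/
theorem Integral.norm_ev_le_norm {g : C⟦X⟧} (hg : Integral g)
    (hg0 : PowerSeries.constantCoeff g = 0) {z : C} (hz : ‖z‖ ≤ 1) : ‖ev g z‖ ≤ ‖z‖ := by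
  refine norm_ev_le fun n => ?_
  rcases n with _ | n
  · simp [hg0]
  · calc _ ≤ 1 * ‖z‖ ^ (n + 1) := by gcongr; exact hg _
      _ ≤ 1 * ‖z‖ ^ 1 := by
        gcongr 1
        exact pow_le_pow_of_le_one (norm_nonneg z) hz (by omega)
      _ = ‖z‖ := by simp

theorem ev_pow [CompleteSpace C] {g : C⟦X⟧} (hg : Integral g) {z : C} (hz : ‖z‖ < 1) (n : ℕ) :
    ev (g ^ n) z = ev g z ^ n := by
  induction n with
  | zero => simp [ev_one]
  | succ n ih => rw [pow_succ, ev_mul (hg.pow n).convOnDisk hg.convOnDisk hz, ih, pow_succ]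

theorem ev_subst [CompleteSpace C] {f g : C⟦X⟧} (hf : ConvOnDisk f) (hg : Integral g)
    (hg0 : PowerSeries.constantCoeff g = 0) {z : C} (hz : ‖z‖ < 1) :
    ev (f.subst g) z = ev f (ev g z) := by
  have hsub : PowerSeries.HasSubst g := PowerSeries.HasSubst.of_constantCoeff_zero' hg0
  have hvan : ∀ k n, n < k → PowerSeries.coeff n (g ^ k) = 0 := fun k n hn =>
    PowerSeries.coeff_of_lt_order _ (lt_of_lt_of_le (by exact_mod_cast hn)
      (PowerSeries.le_order_pow_of_constantCoeff_eq_zero k hg0))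
  -- Only terms with `k ≤ n` survive in the double series, and there `‖z‖ ^ n = s ^ n * s ^ n ≤ s ^
  -- k * s ^ n`. One factor makes the sum over `k` converge, the other the sum over `n`, so the sums
  -- may be exchanged.
  set s := √‖z‖ with hs
  have hs0 : 0 ≤ s := Real.sqrt_nonneg _
  have hs1 : s < 1 := by
    rw [hs, Real.sqrt_lt' one_pos]; simpa using hz
  have hs2 : ‖z‖ = s * s := (Real.mul_self_sqrt (norm_nonneg z)).symm
  have hsum : Summable fun q : ℕ × ℕ =>
      PowerSeries.coeff q.1 f * (PowerSeries.coeff q.2 (g ^ q.1) * z ^ q.2) := by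
    have hf0 : ∀ n, 0 ≤ ‖PowerSeries.coeff n f‖ * s ^ n := fun n =>
      mul_nonneg (norm_nonneg _) (pow_nonneg hs0 n)
    have hg0 : ∀ n, 0 ≤ s ^ n := fun n => pow_nonneg hs0 n
    have hfg := summable_prod_mul_of_nonneg (hf s hs0 hs1) (summable_geometric_of_lt_one hs0 hs1)
      hf0 hg0
    refine hfg.of_norm_bounded fun q => ?_
    obtain ⟨k, n⟩ := q
    change ‖PowerSeries.coeff k f * (PowerSeries.coeff n (g ^ k) * z ^ n)‖ ≤
      ‖PowerSeries.coeff k f‖ * s ^ k * s ^ n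
    rcases lt_or_ge n k with h | h
    · rw [hvan k n h, zero_mul, mul_zero, norm_zero]
      exact mul_nonneg (hf0 k) (hg0 n)
    · rw [norm_mul, norm_mul, norm_pow, hs2, mul_assoc, mul_pow]
      refine mul_le_mul_of_nonneg_left ?_ (norm_nonneg _)
      exact (mul_le_of_le_one_left (mul_nonneg (hg0 n) (hg0 n)) (hg.pow k n)).trans
        (mul_le_mul_of_nonneg_right (pow_le_pow_of_le_one hs0 hs1.le h) (hg0 n))
  calc ev (f.subst g) z
      = ∑' n, ∑' k, PowerSeries.coeff k f * (PowerSeries.coeff n (g ^ k) * z ^ n) := by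
        refine tsum_congr fun n => ?_
        rw [PowerSeries.coeff_subst' hsub, finsum_eq_sum_of_support_subset
          (s := Finset.range (n + 1)), tsum_eq_sum (s := Finset.range (n + 1)), Finset.sum_mul]
        · exact Finset.sum_congr rfl fun k _ => by simp [mul_assoc]
        · intro k hk
          rw [hvan k n (by simpa using hk)]; simp
        · intro k hk
          by_contra h
          rw [Function.mem_support, hvan k n (by simpa using h)] at hk
          simp at hk
    _ = ∑' k, ∑' n, PowerSeries.coeff k f * (PowerSeries.coeff n (g ^ k) * z ^ n) :=
        Summable.tsum_comm (f := fun k n =>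
          PowerSeries.coeff k f * (PowerSeries.coeff n (g ^ k) * z ^ n)) hsum
    _ = ∑' k, PowerSeries.coeff k f * ev g z ^ k := by
        refine tsum_congr fun k => ?_
        rw [tsum_mul_left, ← ev_pow hg hz, ev]
    _ = _ := rfl

end Integral

end Evaluation

/-! ### The ring of integers of a discrete norm and Weierstrass preparation. -/

section IntegerRing

variable {E : Type*} [NontriviallyNormedField E] [IsUltrametricDist E]

theorem mem_integers {x : E} : x ∈ Integers E ↔ ‖x‖ ≤ 1 := by
  rw [Valuation.mem_valuationSubring_iff, NormedField.valuation_apply, ← NNReal.coe_le_coe]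
  simp

theorem norm_le_one_of_integers (x : Integers E) : ‖(x : E)‖ ≤ 1 := mem_integers.1 x.2

theorem isUnit_integers_iff {x : Integers E} : IsUnit x ↔ ‖(x : E)‖ = 1 := by
  constructor
  · rintro ⟨u, rfl⟩
    refine le_antisymm (norm_le_one_of_integers _) ?_
    have h : ((u : Integers E) : E) * ((u⁻¹ : (Integers E)ˣ) : Integers E) = 1 := by
      exact_mod_cast congrArg Subtype.val u.mul_inv
    have h' := congrArg norm h
    rw [norm_mul, norm_one] at h'
    calc (1 : ℝ) = _ := h'.symm
      _ ≤ ‖((u : Integers E) : E)‖ * 1 := by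
        gcongr; exact norm_le_one_of_integers _
      _ = _ := mul_one _
  · intro h
    have hx : (x : E) ≠ 0 := norm_ne_zero_iff.1 (by rw [h]; exact one_ne_zero)
    exact IsUnit.of_mul_eq_one ⟨(x : E)⁻¹, mem_integers.2 (by rw [norm_inv, h, inv_one])⟩
      (Subtype.ext (mul_inv_cancel₀ hx))

theorem mem_maximalIdeal_integers {x : Integers E} :
    x ∈ IsLocalRing.maximalIdeal (Integers E) ↔ ‖(x : E)‖ < 1 := by
  rw [IsLocalRing.mem_maximalIdeal, mem_nonunits_iff, isUnit_integers_iff]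
  exact ⟨fun h => lt_of_le_of_ne (norm_le_one_of_integers x) h, fun h => h.ne⟩

theorem norm_le_pow_of_mem_maximalIdeal_pow {c : ℝ} (hc : ∀ x : E, ‖x‖ < 1 → ‖x‖ ≤ c) (n : ℕ)
    {x : Integers E} (hx : x ∈ IsLocalRing.maximalIdeal (Integers E) ^ n) : ‖(x : E)‖ ≤ c ^ n := by
  have hc0 : 0 ≤ c := by simpa using hc 0 (by simp)
  induction n generalizing x with
  | zero => simpa using norm_le_one_of_integers x
  | succ n ih =>
    rw [pow_succ] at hx
    refine Submodule.mul_induction_on hx (fun a ha b hb => ?_) (fun a b ha hb => ?_)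
    · rw [MulMemClass.coe_mul, norm_mul, pow_succ]
      exact mul_le_mul (ih ha) (hc _ (mem_maximalIdeal_integers.1 hb)) (norm_nonneg _)
        (pow_nonneg hc0 n)
    · rw [AddMemClass.coe_add]
      exact (IsUltrametricDist.norm_add_le_max _ _).trans (max_le ha hb)

theorem mem_maximalIdeal_pow_of_norm_le {t : E} (ht0 : t ≠ 0) (ht : ‖t‖ < 1) (n : ℕ)
    {x : Integers E} (hx : ‖(x : E)‖ ≤ ‖t‖ ^ n) :
    x ∈ IsLocalRing.maximalIdeal (Integers E) ^ n := by
  have htm : (⟨t, mem_integers.2 ht.le⟩ : Integers E) ∈ IsLocalRing.maximalIdeal (Integers E) :=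
    mem_maximalIdeal_integers.2 ht
  have hq : ‖(x : E) / t ^ n‖ ≤ 1 := by
    rw [norm_div, norm_pow]
    exact div_le_one_of_le₀ hx (by positivity)
  have : x = ⟨t, mem_integers.2 ht.le⟩ ^ n * ⟨(x : E) / t ^ n, mem_integers.2 hq⟩ := by
    apply Subtype.ext
    simp only [MulMemClass.coe_mul, SubmonoidClass.coe_pow]
    field_simp
  rw [this]
  exact Ideal.mul_mem_right _ _ (Ideal.pow_mem_pow htm n)

/-- The power `𝔪 ^ n` lies in the ball of radius `c ^ n` and contains the one of radius `‖t‖ ^ n`,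
so the `𝔪`-adic and norm topologies agree. The gap `c < 1` is essential: without it `𝔪 ^ n` need not
shrink. Adic completeness is what Weierstrass preparation requires. -/
theorem isAdicComplete_integers [CompleteSpace E] {c : ℝ} (hc1 : c < 1)
    (hc : ∀ x : E, ‖x‖ < 1 → ‖x‖ ≤ c) :
    IsAdicComplete (IsLocalRing.maximalIdeal (Integers E)) (Integers E) := by
  have hc0 : 0 ≤ c := by simpa using hc 0 (by simp)
  obtain ⟨t, ht0', ht⟩ := NormedField.exists_norm_lt_one E
  have ht0 : t ≠ 0 := norm_pos_iff.1 ht0'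
  have hlim := tendsto_pow_atTop_nhds_zero_of_lt_one hc0 hc1
  refine { haus' := fun x hx => ?_, prec' := fun f hf => ?_ }
  · have h : ∀ n, ‖(x : E)‖ ≤ c ^ n := fun n => by
      have := hx n
      rw [SModEq.zero, smul_eq_mul, Ideal.mul_top] at this
      exact norm_le_pow_of_mem_maximalIdeal_pow hc n this
    have h0 : ‖(x : E)‖ ≤ 0 := ge_of_tendsto' hlim h
    exact Subtype.ext (norm_le_zero_iff.1 h0)
  · simp only [SModEq.sub_mem, smul_eq_mul, Ideal.mul_top] at hf ⊢
    have hd : ∀ m n, m ≤ n → ‖(f m : E) - f n‖ ≤ c ^ m := fun m n hmn =>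
      norm_le_pow_of_mem_maximalIdeal_pow hc m (x := f m - f n) (hf hmn)
    have hcau : CauchySeq fun n => (f n : E) := by
      refine cauchySeq_of_le_tendsto_0 (fun n => 2 * c ^ n) (fun n m N hn hm => ?_)
        (by simpa using hlim.const_mul 2)
      calc dist (f n : E) (f m) ≤ dist (f N : E) (f n) + dist (f N : E) (f m) :=
            dist_triangle_left _ _ _
        _ ≤ c ^ N + c ^ N := by
          rw [dist_eq_norm, dist_eq_norm]; exact add_le_add (hd N n hn) (hd N m hm)
        _ = _ := by ring
    obtain ⟨L, hL⟩ := cauchySeq_tendsto_of_complete hcau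
    have hL1 : ‖L‖ ≤ 1 := le_of_tendsto' hL.norm fun n => norm_le_one_of_integers (f n)
    refine ⟨⟨L, mem_integers.2 hL1⟩, fun n => ?_⟩
    have htn : 0 < ‖t‖ ^ n := by positivity
    obtain ⟨N, hN, hnN⟩ := (((Metric.tendsto_nhds.1 hL) _ htn).and
      (Filter.eventually_ge_atTop n)).exists
    rw [← sub_add_sub_cancel (f n) (f N)]
    refine Ideal.add_mem _ (hf hnN) (mem_maximalIdeal_pow_of_norm_le ht0 ht n ?_)
    rw [dist_eq_norm] at hN
    exact hN.le

/-- **Weierstrass preparation** for integral power series over a complete field whose norm is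
discrete. -/
theorem exists_distinguished_mul_unit [CompleteSpace E] {c : ℝ} (hc1 : c < 1)
    (hc : ∀ x : E, ‖x‖ < 1 → ‖x‖ ≤ c) {g : E⟦X⟧} (hg : Integral g)
    (h1 : ∃ n, ‖PowerSeries.coeff n g‖ = 1) :
    ∃ (P : Polynomial E) (h : E⟦X⟧), P.Monic ∧ (∀ i < P.natDegree, ‖P.coeff i‖ ≤ c) ∧
      Integral h ∧ ‖PowerSeries.constantCoeff h‖ = 1 ∧ g = P * h := by
  have := isAdicComplete_integers hc1 hc
  set g' : (Integers E)⟦X⟧ := PowerSeries.mk fun n => ⟨PowerSeries.coeff n g,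
    mem_integers.2 (hg n)⟩ with hg'
  have hmap : g'.map (algebraMap (Integers E) E) = g := by
    ext n; simp [hg']
  have hres : g'.map (IsLocalRing.residue (Integers E)) ≠ 0 := by
    obtain ⟨n, hn⟩ := h1
    intro h0
    have := congrArg (PowerSeries.coeff n) h0
    rw [PowerSeries.coeff_map, map_zero, IsLocalRing.residue_eq_zero_iff,
      mem_maximalIdeal_integers] at this
    simp [hg', hn] at this
  obtain ⟨P, h, hP⟩ := PowerSeries.exists_isWeierstrassFactorization hres
  refine ⟨P.map (algebraMap (Integers E) E), h.map (algebraMap (Integers E) E),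
    hP.isDistinguishedAt.monic.map _, fun i hi => ?_, fun n => ?_, ?_, ?_⟩
  · rw [hP.isDistinguishedAt.monic.natDegree_map] at hi
    rw [Polynomial.coeff_map]
    exact hc _ (mem_maximalIdeal_integers.1 (hP.isDistinguishedAt.mem hi))
  · rw [PowerSeries.coeff_map]
    exact norm_le_one_of_integers _
  · rw [← PowerSeries.coeff_zero_eq_constantCoeff_apply, PowerSeries.coeff_map]
    refine isUnit_integers_iff.1 ?_
    rw [PowerSeries.coeff_zero_eq_constantCoeff_apply]
    exact PowerSeries.isUnit_iff_constantCoeff.1 hP.isUnit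
  · rw [← hmap, hP.eq_mul, map_mul, Polynomial.polynomial_map_coe]

omit [IsUltrametricDist E] in
/-- A bounded family in a field with a discrete norm attains its largest norm. -/
theorem exists_norm_max {c : ℝ} (hc1 : c < 1) (hc : ∀ x : E, ‖x‖ < 1 → ‖x‖ ≤ c) {ι : Type*}
    [Nonempty ι] {a : ι → E} {M : ℝ} (hM : ∀ i, ‖a i‖ ≤ M) : ∃ i, ∀ j, ‖a j‖ ≤ ‖a i‖ := by
  have hc0 : 0 ≤ c := by simpa using hc 0 (by simp)
  have hb : BddAbove (Set.range fun i => ‖a i‖) := ⟨M, by rintro _ ⟨i, rfl⟩; exact hM i⟩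
  set S := ⨆ i, ‖a i‖ with hS
  have hle : ∀ j, ‖a j‖ ≤ S := fun j => le_ciSup hb j
  have hS0 : 0 ≤ S := Real.iSup_nonneg fun i => norm_nonneg _
  rcases hS0.eq_or_lt with h0 | h0
  · obtain ⟨i⟩ := ‹Nonempty ι›
    exact ⟨i, fun j => ((hle j).trans h0.symm.le).trans (norm_nonneg _)⟩
  -- Any `i` with `‖a i‖ > c * S` is already maximal: a larger `‖a j‖` would force `‖a i‖ ≤ c * ‖a
  -- j‖ ≤ c * S` by the gap.
  · obtain ⟨i, hi⟩ := exists_lt_of_lt_ciSup (show c * S < ⨆ i, ‖a i‖ from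
      mul_lt_of_lt_one_left h0 hc1)
    refine ⟨i, fun j => ?_⟩
    by_contra! h
    have hj : 0 < ‖a j‖ := (norm_nonneg _).trans_lt h
    have := hc (a i / a j) (by rw [norm_div]; exact (div_lt_one hj).2 h)
    rw [norm_div, div_le_iff₀ hj] at this
    exact absurd (this.trans (mul_le_mul_of_nonneg_left (hle j) hc0)) (not_le.2 hi)

/-- Weierstrass preparation for bounded power series over a complete field whose norm is
discrete. -/
theorem exists_C_mul_distinguished_mul_unit [CompleteSpace E] {c : ℝ} (hc1 : c < 1)
    (hc : ∀ x : E, ‖x‖ < 1 → ‖x‖ ≤ c) {g : E⟦X⟧} (hg0 : g ≠ 0) {M : ℝ}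
    (hM : ∀ n, ‖PowerSeries.coeff n g‖ ≤ M) :
    ∃ (s : E) (P : Polynomial E) (h : E⟦X⟧), s ≠ 0 ∧ (∀ n, ‖PowerSeries.coeff n g‖ ≤ ‖s‖) ∧
      P.Monic ∧ (∀ i < P.natDegree, ‖P.coeff i‖ ≤ c) ∧
      Integral h ∧ ‖PowerSeries.constantCoeff h‖ = 1 ∧ g = PowerSeries.C s * (P * h) := by
  obtain ⟨N, hN⟩ := exists_norm_max hc1 hc hM
  set s := PowerSeries.coeff N g with hs
  have hs0 : s ≠ 0 := by
    intro h
    refine hg0 (PowerSeries.ext fun n => ?_)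
    have := hN n
    rw [h, norm_zero] at this
    rw [norm_le_zero_iff.1 this, map_zero]
  have hs' : 0 < ‖s‖ := norm_pos_iff.2 hs0
  obtain ⟨P, h, h1, h2, h3, h4, h5⟩ := exists_distinguished_mul_unit hc1 hc
    (g := PowerSeries.C s⁻¹ * g)
    (fun n => by
      rw [PowerSeries.coeff_C_mul, norm_mul, norm_inv, inv_mul_le_iff₀ hs', mul_one]
      exact hN n)
    ⟨N, by rw [PowerSeries.coeff_C_mul, ← hs, inv_mul_cancel₀ hs0, norm_one]⟩
  refine ⟨s, P, h, hs0, hN, h1, h2, h3, h4, ?_⟩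
  rw [← h5, ← mul_assoc, ← map_mul, mul_inv_cancel₀ hs0, map_one, one_mul]

end IntegerRing

/-! ### Integral series with constant term of norm one. -/

section UnitSeries

variable {C : Type*} [NormedField C] [IsUltrametricDist C]

/-- The non-constant part has norm at most `‖w‖ < 1` at `w`, so the constant term dominates. In
particular such a series has no zeros in the disk. -/
theorem norm_ev_eq_one [CompleteSpace C] {h : C⟦X⟧} (hh : Integral h)
    (h0 : ‖PowerSeries.constantCoeff h‖ = 1) {w : C} (hw : ‖w‖ < 1) : ‖ev h w‖ = 1 := by
  set h1 : C⟦X⟧ := PowerSeries.mk fun n => if n = 0 then 0 else PowerSeries.coeff n h with hh1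
  have hint : Integral h1 := fun n => by
    rw [hh1, PowerSeries.coeff_mk]; split_ifs
    · simp
    · exact hh n
  have hdec : h = PowerSeries.C (PowerSeries.constantCoeff h) + h1 := by
    ext n
    rw [map_add, PowerSeries.coeff_C, hh1, PowerSeries.coeff_mk]
    split_ifs with hn
    · subst hn; simp
    · simp
  have hlt : ‖ev h1 w‖ < 1 :=
    (hint.norm_ev_le_norm (by rw [← PowerSeries.coeff_zero_eq_constantCoeff_apply, hh1]; simp)
      hw.le).trans_lt hw
  rw [hdec, ev_add (convOnDisk_C _) hint.convOnDisk hw, ev_C,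
    IsUltrametricDist.norm_add_eq_max_of_norm_ne_norm (by rw [h0]; exact hlt.ne'), h0]
  exact max_eq_left hlt.le

/-- Solve recursively for the coefficients of `v`: the `n`-th one occurs in `h * v` multiplied by
the constant term of `h`, of norm `1`, and all other terms involve earlier coefficients. -/
theorem integral_of_mul_integral {h v : C⟦X⟧} (hh : Integral h)
    (h0 : ‖PowerSeries.constantCoeff h‖ = 1) (hv : Integral (h * v)) : Integral v := by
  intro n
  induction n using Nat.strong_induction_on with
  | _ n ih =>
    have key := hv n
    rw [PowerSeries.coeff_mul, Finset.Nat.sum_antidiagonal_eq_sum_range_succ_mk,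
      Finset.sum_range_succ'] at key
    simp only [PowerSeries.coeff_zero_eq_constantCoeff, Nat.sub_zero] at key
    have hS : ‖∑ k ∈ Finset.range n,
        PowerSeries.coeff (k + 1) h * PowerSeries.coeff (n - (k + 1)) v‖ ≤ 1 := by
      refine IsUltrametricDist.norm_sum_le_of_forall_le_of_nonneg zero_le_one fun k hk => ?_
      rw [norm_mul]
      exact mul_le_one₀ (hh _) (norm_nonneg _)
        (ih _ (by have := Finset.mem_range.1 hk; omega))
    rw [← norm_neg] at hS
    have := (IsUltrametricDist.norm_add_le_max _ _).trans (max_le key hS)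
    rwa [add_comm, neg_add_cancel_left, norm_mul, h0, one_mul] at this

end UnitSeries

/-! ### Growth and zeros of bounded series, read off from the distinguished polynomial. -/

section Embedding

variable {E : Type*} [NontriviallyNormedField E] [IsUltrametricDist E]
variable {C : Type*} [NormedField C] [IsUltrametricDist C]

omit [IsUltrametricDist E] in
/-- If the lower coefficients of a monic polynomial are small compared with `‖w‖`, then the leading
term dominates at `w`. -/
theorem norm_eval_map_of_lt_pow {φ : E →+* C} (hφ : ∀ x, ‖φ x‖ = ‖x‖) {c : ℝ} (hc1 : c < 1)
    {P : Polynomial E} (hP : P.Monic) (hPc : ∀ i < P.natDegree, ‖P.coeff i‖ ≤ c) {w : C}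
    (hw : c < ‖w‖ ^ P.natDegree) : ‖(P.map φ).eval w‖ = ‖w‖ ^ P.natDegree := by
  have hlow : ∀ i < P.natDegree, ‖φ (P.coeff i) * w ^ i‖ < ‖w‖ ^ P.natDegree := fun i hi => by
    rw [norm_mul, hφ, norm_pow]
    have hc0 : 0 ≤ c := (norm_nonneg _).trans (hPc i hi)
    rcases le_or_gt ‖w‖ 1 with h | h
    · exact (mul_le_of_le_one_right (norm_nonneg _)
        (pow_le_one₀ (norm_nonneg w) h)).trans_lt ((hPc i hi).trans_lt hw)
    · calc ‖P.coeff i‖ * ‖w‖ ^ i < 1 * ‖w‖ ^ i := by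
            gcongr; exact (hPc i hi).trans_lt hc1
        _ ≤ ‖w‖ ^ P.natDegree := by
            rw [one_mul]; exact pow_le_pow_right₀ h.le hi.le
  rw [Polynomial.eval_eq_sum_range, hP.natDegree_map, Finset.sum_range_succ]
  simp only [Polynomial.coeff_map]
  rw [hP.coeff_natDegree, map_one, one_mul]
  rcases Nat.eq_zero_or_pos P.natDegree with h0 | h0
  · simp [h0]
  · obtain ⟨i, hi, hle⟩ := IsUltrametricDist.exists_norm_finsetSum_le (Finset.range P.natDegree)
      fun i => φ (P.coeff i) * w ^ i
    have hlt := hle.trans_lt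
      (hlow i (Finset.mem_range.1 (hi (Finset.nonempty_range_iff.2 h0.ne'))))
    rw [← norm_pow] at hlt ⊢
    rw [IsUltrametricDist.norm_add_eq_max_of_norm_ne_norm hlt.ne]
    exact max_eq_right hlt.le

omit [IsUltrametricDist E] [IsUltrametricDist C] in
theorem Integral.map {φ : E →+* C} (hφ : ∀ x, ‖φ x‖ = ‖x‖) {h : E⟦X⟧} (hh : Integral h) :
    Integral (h.map φ) := fun n => by rw [PowerSeries.coeff_map, hφ]; exact hh n

variable [CompleteSpace E] [CompleteSpace C]

omit [IsUltrametricDist E] [CompleteSpace E] in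
theorem ev_map_C_mul_mul {φ : E →+* C} (hφ : ∀ x, ‖φ x‖ = ‖x‖) {c : ℝ} (hc1 : c < 1)
    (s : E) {P : Polynomial E} {h : E⟦X⟧} (hP : P.Monic)
    (hPc : ∀ i < P.natDegree, ‖P.coeff i‖ ≤ c) (hh : Integral h) {w : C} (hw : ‖w‖ < 1) :
    ev ((PowerSeries.C s * (P * h)).map φ) w
      = φ s * ((P.map φ).eval w * ev (h.map φ) w) := by
  have hPint : Integral ((P.map φ : Polynomial C) : C⟦X⟧) := fun n => by
    rw [Polynomial.coeff_coe, Polynomial.coeff_map, hφ]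
    rcases lt_trichotomy n P.natDegree with hn | hn | hn
    · exact (hPc n hn).trans hc1.le
    · rw [hn, hP.coeff_natDegree, norm_one]
    · rw [Polynomial.coeff_eq_zero_of_natDegree_lt hn, norm_zero]; exact zero_le_one
  rw [map_mul, map_mul, PowerSeries.map_C, ← Polynomial.polynomial_map_coe,
    ev_C_mul _ (hPint.mul (hh.map hφ)).convOnDisk hw,
    ev_mul hPint.convOnDisk (hh.map hφ).convOnDisk hw, ev_coe]

/-- The growth of a bounded power series near the boundary of the unit disk. -/
theorem exists_norm_ev_eq {φ : E →+* C} (hφ : ∀ x, ‖φ x‖ = ‖x‖) {c : ℝ} (hc1 : c < 1)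
    (hc : ∀ x : E, ‖x‖ < 1 → ‖x‖ ≤ c) {g : E⟦X⟧} (hg0 : g ≠ 0) {M : ℝ}
    (hM : ∀ n, ‖PowerSeries.coeff n g‖ ≤ M) :
    ∃ (s : E) (d : ℕ) (r : ℝ), s ≠ 0 ∧ (∀ n, ‖PowerSeries.coeff n g‖ ≤ ‖s‖) ∧ r < 1 ∧
      ∀ w : C, r < ‖w‖ → ‖w‖ < 1 → ‖ev (g.map φ) w‖ = ‖s‖ * ‖w‖ ^ d := by
  obtain ⟨s, P, h, hs, hle, hP, hPc, hh, hh0, rfl⟩ :=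
    exists_C_mul_distinguished_mul_unit hc1 hc hg0 hM
  have hlim : Filter.Tendsto (fun r : ℝ => r ^ P.natDegree) (nhdsWithin 1 (Set.Iio 1)) (nhds 1) := by
    have : Filter.Tendsto (fun r : ℝ => r ^ P.natDegree) (nhds 1) (nhds 1) := by
      simpa using (continuous_pow (M := ℝ) P.natDegree).tendsto 1
    exact this.mono_left nhdsWithin_le_nhds
  -- The radius `r` satisfies `c < r ^ P.natDegree`, so that the leading term of `P` dominates
  -- beyond it.
  obtain ⟨r, hr, hr1, hr0⟩ := ((hlim.eventually (lt_mem_nhds hc1)).and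
    (Filter.Eventually.and (Filter.eventually_of_mem self_mem_nhdsWithin fun x hx => hx)
      (nhdsWithin_le_nhds (lt_mem_nhds (zero_lt_one (α := ℝ)))))).exists
  refine ⟨s, P.natDegree, r, hs, hle, hr1, fun w hw hw1 => ?_⟩
  rw [ev_map_C_mul_mul hφ hc1 s hP hPc hh hw1, norm_mul, norm_mul, hφ,
    norm_eval_map_of_lt_pow hφ hc1 hP hPc, norm_ev_eq_one (hh.map hφ) _ hw1, mul_one]
  · rw [← PowerSeries.coeff_zero_eq_constantCoeff_apply, PowerSeries.coeff_map, hφ]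
    simpa using hh0
  · exact hr.trans_le (pow_le_pow_left₀ (le_of_lt hr0) hw.le _)

omit [IsUltrametricDist E] [CompleteSpace E] in
/-- The roots of a distinguished polynomial are the zeros in the open unit disk of its product with
a unit, and simple zeros correspond to simple roots. -/
theorem roots_of_distinguished {φ : E →+* C} (hφ : ∀ x, ‖φ x‖ = ‖x‖) {c : ℝ} (hc1 : c < 1)
    {s : E} (hs : s ≠ 0) {P : Polynomial E} {h : E⟦X⟧} (hP : P.Monic)
    (hPc : ∀ i < P.natDegree, ‖P.coeff i‖ ≤ c) (hh : Integral h)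
    (hh0 : ‖PowerSeries.constantCoeff h‖ = 1)
    (hsimple : ∀ w : C, ‖w‖ < 1 → ev ((PowerSeries.C s * (P * h)).map φ) w = 0 →
      ev (PowerSeries.derivative C ((PowerSeries.C s * (P * h)).map φ)) w ≠ 0) :
    (P.map φ).roots.Nodup ∧ ∀ w : C, w ∈ (P.map φ).roots ↔
      ‖w‖ < 1 ∧ ev ((PowerSeries.C s * (P * h)).map φ) w = 0 := by
  have hP0 : P.map φ ≠ 0 := (hP.map φ).ne_zero
  have hφs : φ s ≠ 0 := norm_ne_zero_iff.1 (by rw [hφ]; exact norm_ne_zero_iff.2 hs)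
  have hφh0 : ‖PowerSeries.constantCoeff (h.map φ)‖ = 1 := by
    rw [← PowerSeries.coeff_zero_eq_constantCoeff_apply, PowerSeries.coeff_map, hφ]
    simpa using hh0
  have hroot : ∀ w : C, w ∈ (P.map φ).roots ↔
      ‖w‖ < 1 ∧ ev ((PowerSeries.C s * (P * h)).map φ) w = 0 := by
    intro w
    rw [Polynomial.mem_roots hP0, Polynomial.IsRoot.def]
    constructor
    · intro h0
      have hw : ‖w‖ < 1 := by
        by_contra! hw
        have h1 : 1 ≤ ‖w‖ ^ P.natDegree := one_le_pow₀ hw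
        have := norm_eval_map_of_lt_pow hφ hc1 hP hPc (w := w) (hc1.trans_le h1)
        rw [h0, norm_zero] at this
        linarith
      exact ⟨hw, by rw [ev_map_C_mul_mul hφ hc1 s hP hPc hh hw, h0]; ring⟩
    · rintro ⟨hw, h0⟩
      rw [ev_map_C_mul_mul hφ hc1 s hP hPc hh hw] at h0
      have h1 : ev (h.map φ) w ≠ 0 := norm_ne_zero_iff.1
        (by rw [norm_ev_eq_one (hh.map hφ) hφh0 hw]; exact one_ne_zero)
      exact ((mul_eq_zero.1 ((mul_eq_zero.1 h0).resolve_left hφs)).resolve_right h1)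
  refine ⟨?_, hroot⟩
  classical
  rw [Multiset.nodup_iff_count_le_one]
  intro w
  rw [Polynomial.count_roots]
  by_contra! hlt
  -- A multiple root is a zero of the polynomial and of its derivative, so the product rule makes
  -- the derivative of the whole series vanish there.
  obtain ⟨h0, h1⟩ := (Polynomial.one_lt_rootMultiplicity_iff_isRoot hP0).1 hlt
  obtain ⟨hw, hz⟩ := (hroot w).1 ((Polynomial.mem_roots hP0).2 h0)
  refine hsimple w hw hz ?_
  have hder : PowerSeries.derivative C ((PowerSeries.C s * (P * h)).map φ) =
      PowerSeries.C (φ s) * (((P.map φ : Polynomial C) : C⟦X⟧) *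
        PowerSeries.derivative C (h.map φ) +
        h.map φ * ((Polynomial.derivative (P.map φ) : Polynomial C) : C⟦X⟧)) := by
    rw [map_mul (PowerSeries.map φ), map_mul (PowerSeries.map φ), PowerSeries.map_C,
      ← Polynomial.polynomial_map_coe, Derivation.leibniz,
      Derivation.leibniz, PowerSeries.derivative_C, PowerSeries.derivative_coe]
    simp
  have hd := (hh.map hφ).convOnDisk.derivative
  have hp1 := (convOnDisk_coe (P.map φ)).mul hd
  have hp2 := (hh.map hφ).convOnDisk.mul (convOnDisk_coe (Polynomial.derivative (P.map φ)))
  rw [hder, ev_C_mul _ (hp1.add hp2) hw, ev_add hp1 hp2 hw, ev_mul (convOnDisk_coe _) hd hw,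
    ev_mul (hh.map hφ).convOnDisk (convOnDisk_coe _) hw, ev_coe, ev_coe, h0.eq_zero, h1.eq_zero]
  ring

/-- If `f = g * u` with `u(0) = 1`, where `f` and `g` have the same zeros in the open unit disk and
all these zeros are simple, then `u` has integral coefficients. -/
theorem integral_of_same_zeros {φ : E →+* C} (hφ : ∀ x, ‖φ x‖ = ‖x‖) {c : ℝ} (hc1 : c < 1)
    (hc : ∀ x : E, ‖x‖ < 1 → ‖x‖ ≤ c) (hsplit : ∀ P : Polynomial E, (P.map φ).Splits)
    {f g u : E⟦X⟧} (hf0 : f ≠ 0) {Mf Mg : ℝ} (hf : ∀ n, ‖PowerSeries.coeff n f‖ ≤ Mf)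
    (hg : ∀ n, ‖PowerSeries.coeff n g‖ ≤ Mg) (hu : PowerSeries.constantCoeff u = 1)
    (hfu : f = g * u)
    (hzero : ∀ w : C, ‖w‖ < 1 → (ev (f.map φ) w = 0 ↔ ev (g.map φ) w = 0))
    (hfs : ∀ w : C, ‖w‖ < 1 → ev (f.map φ) w = 0 →
      ev (PowerSeries.derivative C (f.map φ)) w ≠ 0)
    (hgs : ∀ w : C, ‖w‖ < 1 → ev (g.map φ) w = 0 →
      ev (PowerSeries.derivative C (g.map φ)) w ≠ 0) : Integral u := by
  have hg0 : g ≠ 0 := by rintro rfl; exact hf0 (by rw [hfu, zero_mul])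
  obtain ⟨s, P, h, hs, -, hP, hPc, hh, hh0, rfl⟩ :=
    exists_C_mul_distinguished_mul_unit hc1 hc hf0 hf
  obtain ⟨t, Q, k, ht, -, hQ, hQc, hk, hk0, rfl⟩ :=
    exists_C_mul_distinguished_mul_unit hc1 hc hg0 hg
  obtain ⟨hPn, hPr⟩ := roots_of_distinguished hφ hc1 hs hP hPc hh hh0 hfs
  obtain ⟨hQn, hQr⟩ := roots_of_distinguished hφ hc1 ht hQ hQc hk hk0 hgs
  have hroots : (P.map φ).roots = (Q.map φ).roots := by
    refine (Multiset.Nodup.ext hPn hQn).2 fun w => ?_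
    rw [hPr, hQr]
    exact and_congr_right fun hw => hzero w hw
  have hPQ : P = Q := by
    refine Polynomial.map_injective φ φ.injective ?_
    rw [(hsplit P).eq_prod_roots_of_monic (hP.map φ), (hsplit Q).eq_prod_roots_of_monic (hQ.map φ),
      hroots]
  -- Cancelling the common polynomial leaves `k * u` equal to a constant times `h`; comparing
  -- constant terms shows that the constant has norm `1`.
  subst hPQ
  have hP0 : (P : E⟦X⟧) ≠ 0 := by
    rw [Ne, Polynomial.coe_eq_zero_iff]; exact hP.ne_zero
  have hcancel : PowerSeries.C s * h = PowerSeries.C t * (k * u) := by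
    refine mul_left_cancel₀ hP0 ?_
    calc _ = PowerSeries.C s * (P * h) := by ring
      _ = _ := hfu
      _ = _ := by ring
  have hku : k * u = PowerSeries.C (s / t) * h := by
    have ht' : PowerSeries.C t⁻¹ * PowerSeries.C t = (1 : E⟦X⟧) := by
      rw [← map_mul, inv_mul_cancel₀ ht, map_one]
    calc k * u = PowerSeries.C t⁻¹ * PowerSeries.C t * (k * u) := by rw [ht', one_mul]
      _ = PowerSeries.C t⁻¹ * (PowerSeries.C s * h) := by rw [hcancel]; ring
      _ = _ := by rw [← mul_assoc, ← map_mul, div_eq_inv_mul]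
  have hst : ‖s / t‖ = 1 := by
    have := congrArg (fun q => ‖PowerSeries.constantCoeff q‖) hku
    simp only [map_mul, PowerSeries.constantCoeff_C, norm_mul, hu, hk0, hh0,
      mul_one] at this
    exact this.symm
  refine integral_of_mul_integral hk hk0 ?_
  rw [hku]
  intro n
  rw [PowerSeries.coeff_C_mul, norm_mul, hst, one_mul]
  exact hh n

end Embedding

/-! ### Discreteness of the norm passes to finite extensions. -/

section FiniteExtension

/-- In a finite extension of a field with discrete norm the norm is discrete. -/
theorem exists_gap_of_finite {k E : Type*} [Field k] [NormedField E] [IsUltrametricDist E]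
    [Algebra k E] [FiniteDimensional k E] {c : ℝ} (hc1 : c < 1)
    (hc : ∀ x : k, ‖algebraMap k E x‖ < 1 → ‖algebraMap k E x‖ ≤ c) :
    ∃ c' : ℝ, c' < 1 ∧ ∀ x : E, ‖x‖ < 1 → ‖x‖ ≤ c' := by
  have hc0 : 0 ≤ c := by simpa using hc 0 (by simp)
  set d := Module.finrank k E
  have hd : 0 < d := Module.finrank_pos
  refine ⟨c ^ ((d : ℝ)⁻¹), Real.rpow_lt_one hc0 hc1 (by positivity), fun x hx => ?_⟩
  suffices h : ‖x‖ ^ d ≤ c by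
    rw [← Real.pow_rpow_inv_natCast (norm_nonneg x) hd.ne']
    exact Real.rpow_le_rpow (by positivity) h (by positivity)
  rcases eq_or_ne x 0 with rfl | hx0
  · simpa [hd.ne'] using hc0
  have hdep : ¬ LinearIndependent k fun i : Fin (d + 1) => x ^ (i : ℕ) := by
    intro h
    have := h.fintype_card_le_finrank
    simp [d] at this
  rw [Fintype.not_linearIndependent_iff] at hdep
  obtain ⟨a, hsum, i0, hi0⟩ := hdep
  -- In an ultrametric sum of nonzero terms with pairwise distinct norms the largest survives, so a
  -- vanishing sum has two terms of equal norm. Hence some `‖x‖ ^ (j - i)` with `1 ≤ j - i ≤ d` is a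
  -- norm from the base field, where the gap applies.
  have hex : ∃ i j : Fin (d + 1), i < j ∧ a i ≠ 0 ∧ a j ≠ 0 ∧
      ‖a i • x ^ (i : ℕ)‖ = ‖a j • x ^ (j : ℕ)‖ := by
    by_contra! hne
    classical
    have hne0 : (Finset.univ.filter fun i => a i ≠ 0).Nonempty := ⟨i0, by simpa using hi0⟩
    have hmax := IsUltrametricDist.norm_sum_eq_sup'_of_pairwise_ne hne0
      (f := fun i : Fin (d + 1) => a i • x ^ (i : ℕ)) (by
        intro i hi j hj hij
        have hi' : a i ≠ 0 := (Finset.mem_filter.1 hi).2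
        have hj' : a j ≠ 0 := (Finset.mem_filter.1 hj).2
        rcases lt_or_gt_of_ne hij with h | h
        · exact hne i j h hi' hj'
        · exact (hne j i h hj' hi').symm)
    rw [Finset.sum_filter_of_ne (fun i _ h => by rintro h0; simp [h0] at h), hsum,
      norm_zero] at hmax
    have hle := Finset.le_sup' (fun i : Fin (d + 1) => ‖a i • x ^ (i : ℕ)‖)
      (show i0 ∈ Finset.univ.filter fun i => a i ≠ 0 by simpa using hi0)
    rw [← hmax, norm_le_zero_iff] at hle
    exact smul_ne_zero hi0 (pow_ne_zero _ hx0) hle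
  obtain ⟨i, j, hij, hai, haj, heq⟩ := hex
  have hxp : 0 < ‖x‖ := norm_pos_iff.2 hx0
  have haj' : 0 < ‖algebraMap k E (a j)‖ := by
    rw [norm_pos_iff]; simpa using haj
  have hij' : (i : ℕ) < j := hij
  have hratio : ‖algebraMap k E (a i / a j)‖ = ‖x‖ ^ ((j : ℕ) - i) := by
    rw [Algebra.smul_def, Algebra.smul_def, norm_mul, norm_mul, norm_pow, norm_pow,
      ← Nat.add_sub_of_le hij'.le, pow_add, mul_left_comm] at heq
    rw [map_div₀, norm_div, div_eq_iff haj'.ne', mul_comm]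
    have hxi : ‖x‖ ^ (i : ℕ) ≠ 0 := by positivity
    refine mul_right_cancel₀ hxi ?_
    linear_combination heq
  have hlt : ‖x‖ ^ ((j : ℕ) - i) < 1 := pow_lt_one₀ hxp.le hx (by omega)
  calc ‖x‖ ^ d ≤ ‖x‖ ^ ((j : ℕ) - i) := pow_le_pow_of_le_one hxp.le hx.le (by omega)
    _ ≤ c := by rw [← hratio] at hlt ⊢; exact hc _ hlt

end FiniteExtension

/-! ### Norms of natural numbers when `‖p‖ < 1`. -/

section Residue

variable {K : Type*} [NormedField K] [IsUltrametricDist K] {p : ℕ} [hpr : Fact p.Prime]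

/-- A Bézout relation `a p + b m = 1` would have norm less than `1` if both `p` and `m` did. -/
theorem norm_natCast_eq_one (hp : ‖(p : K)‖ < 1) {m : ℕ} (hm : ¬ p ∣ m) : ‖(m : K)‖ = 1 := by
  refine le_antisymm (IsUltrametricDist.norm_natCast_le_one K m) ?_
  by_contra! hlt
  have hcop : IsCoprime (p : ℤ) (m : ℤ) :=
    Nat.isCoprime_iff_coprime.2 ((Nat.Prime.coprime_iff_not_dvd hpr.out).2 hm)
  obtain ⟨a, b, hab⟩ := hcop
  have h1 : (a : K) * p + b * m = 1 := by exact_mod_cast congrArg (Int.cast (R := K)) hab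
  have h2 : ‖(a : K) * p‖ < 1 := by
    rw [norm_mul]
    exact (mul_le_of_le_one_left (norm_nonneg _)
      (IsUltrametricDist.norm_intCast_le_one K a)).trans_lt hp
  have h3 : ‖(b : K) * m‖ < 1 := by
    rw [norm_mul]
    exact (mul_le_of_le_one_left (norm_nonneg _)
      (IsUltrametricDist.norm_intCast_le_one K b)).trans_lt hlt
  have h4 := (IsUltrametricDist.norm_add_le_max _ _).trans_lt (max_lt h2 h3)
  rw [h1, norm_one] at h4
  exact lt_irrefl _ h4

/-- Here `v` is the `p`-adic valuation of `n`; the bound `p ^ v ≤ n` is what limits the denominators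
of the logarithm to polynomial growth. -/
theorem exists_norm_natCast_eq_pow (hp : ‖(p : K)‖ < 1) {n : ℕ} (hn : n ≠ 0) :
    ∃ v : ℕ, p ^ v ≤ n ∧ ‖(n : K)‖ = ‖(p : K)‖ ^ v := by
  obtain ⟨v, m, hm, rfl⟩ := Nat.exists_eq_pow_mul_and_not_dvd hn p hpr.out.ne_one
  refine ⟨v, Nat.le_mul_of_pos_right _ (Nat.pos_of_ne_zero fun h => hm (h ▸ dvd_zero p)), ?_⟩
  rw [Nat.cast_mul, Nat.cast_pow, norm_mul, norm_pow, norm_natCast_eq_one hp hm, mul_one]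

theorem charZero_of_norm_lt_one (hp : ‖(p : K)‖ < 1) (hp0 : (p : K) ≠ 0) : CharZero K := by
  refine charZero_of_inj_zero fun n hn => ?_
  by_contra h
  obtain ⟨v, -, hv⟩ := exists_norm_natCast_eq_pow (K := K) hp h
  rw [hn, norm_zero] at hv
  exact pow_ne_zero v (norm_ne_zero_iff.2 hp0) hv.symm

/-- The inverse of the norm of a positive integer grows at most polynomially. -/
theorem exists_inv_norm_natCast_le (hp : ‖(p : K)‖ < 1) (hp0 : (p : K) ≠ 0) :
    ∃ c : ℕ, ∀ n : ℕ, n ≠ 0 → ‖(n : K)‖⁻¹ ≤ (n : ℝ) ^ c := by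
  obtain ⟨c, hc⟩ := pow_unbounded_of_one_lt ‖(p : K)‖⁻¹
    (show (1 : ℝ) < p by exact_mod_cast hpr.out.one_lt)
  refine ⟨c, fun n hn => ?_⟩
  obtain ⟨v, hv, hnv⟩ := exists_norm_natCast_eq_pow (K := K) hp hn
  rw [hnv, ← inv_pow]
  calc (‖(p : K)‖⁻¹) ^ v ≤ ((p : ℝ) ^ c) ^ v := by gcongr
    _ = ((p : ℝ) ^ v) ^ c := by rw [← pow_mul, ← pow_mul, mul_comm]
    _ ≤ (n : ℝ) ^ c := by gcongr; exact_mod_cast hv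

end Residue

/-! ### The norm on `W(k)[1/p]` and on its finite extensions is discrete. -/

section Witt

theorem natCast_prime_ne_zero_of_witt (p : ℕ) [Fact p.Prime] (k : Type*) [Field k] [CharP k p]
    (K : Type*) [Field K] [Algebra (FractionRing (WittVector p k)) K] : (p : K) ≠ 0 := by
  have h0 : algebraMap (FractionRing (WittVector p k)) K
      (algebraMap (WittVector p k) (FractionRing (WittVector p k)) p) ≠ 0 := by
    rw [map_ne_zero_iff _ (algebraMap (FractionRing (WittVector p k)) K).injective,
      map_ne_zero_iff _ (IsFractionRing.injective (WittVector p k) _)]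
    exact WittVector.p_nonzero p k
  simpa using h0

variable {p : ℕ} [hpr : Fact p.Prime] {k : Type*} [Field k] [CharP k p] [PerfectRing k p]
  {K : Type*} [NormedField K] [Algebra (FractionRing (WittVector p k)) K]

/-- As `k` is perfect, a nonzero Witt vector is a power of `p` times a unit; a unit and its inverse
both have norm at most `1`, hence norm `1`. -/
theorem exists_norm_witt_eq_pow
    (hW : ∀ x : WittVector p k, ‖algebraMap (FractionRing (WittVector p k)) K
      (algebraMap (WittVector p k) (FractionRing (WittVector p k)) x)‖ ≤ 1)
    {x : WittVector p k} (hx : x ≠ 0) :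
    ∃ m : ℕ, ‖algebraMap (FractionRing (WittVector p k)) K
      (algebraMap (WittVector p k) (FractionRing (WittVector p k)) x)‖ = ‖(p : K)‖ ^ m := by
  set φ : WittVector p k →+* K := (algebraMap (FractionRing (WittVector p k)) K).comp
    (algebraMap (WittVector p k) (FractionRing (WittVector p k))) with hφ
  obtain ⟨m, b, rfl⟩ := WittVector.exists_eq_pow_p_mul' x hx
  refine ⟨m, ?_⟩
  have hinv : φ b * φ (b⁻¹ : (WittVector p k)ˣ) = 1 := by
    rw [← map_mul, Units.mul_inv, map_one]
  have hb : ‖φ b‖ = 1 := by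
    refine le_antisymm (hW _) ?_
    have h := congrArg norm hinv
    rw [norm_mul, norm_one] at h
    rw [← h]
    exact mul_le_of_le_one_right (norm_nonneg _) (hW _)
  change ‖φ (p ^ m * b)‖ = _
  rw [map_mul, map_pow, map_natCast, norm_mul, hb, mul_one, norm_pow]

/-- Nonzero elements of the fraction field have norm an integral power of `‖p‖`, so `‖p‖` itself is
a gap there, and the finite extension inherits one. -/
theorem exists_gap_of_witt [IsUltrametricDist K]
    [FiniteDimensional (FractionRing (WittVector p k)) K]
    (hp : ‖(p : K)‖ < 1)
    (hW : ∀ x : WittVector p k, ‖algebraMap (FractionRing (WittVector p k)) K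
      (algebraMap (WittVector p k) (FractionRing (WittVector p k)) x)‖ ≤ 1) :
    ∃ c : ℝ, c < 1 ∧ ∀ x : K, ‖x‖ < 1 → ‖x‖ ≤ c := by
  refine exists_gap_of_finite (k := FractionRing (WittVector p k)) hp fun x hx => ?_
  obtain ⟨a, b, hb, rfl⟩ := IsFractionRing.div_surjective (A := WittVector p k) x
  rcases eq_or_ne a 0 with rfl | ha
  · simp
  obtain ⟨m, hm⟩ := exists_norm_witt_eq_pow hW ha
  obtain ⟨n, hn⟩ := exists_norm_witt_eq_pow hW (nonZeroDivisors.ne_zero hb)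
  have hp0 : 0 < ‖(p : K)‖ := norm_pos_iff.2 (natCast_prime_ne_zero_of_witt p k K)
  rw [map_div₀, norm_div, hm, hn] at hx ⊢
  rcases le_or_gt m n with h | h
  · rw [div_lt_one (by positivity)] at hx
    exact absurd hx (not_lt.2 (pow_le_pow_of_le_one hp0.le hp.le h))
  · rw [div_le_iff₀ (by positivity), ← pow_succ']
    exact pow_le_pow_of_le_one hp0.le hp.le h

end Witt

/-! ### The chain rule for multivariate formal power series. -/

section ChainRule

open MvPowerSeries

variable {R σ τ : Type*} [CommRing R] [Fintype σ]

theorem le_order_subst_of_le {a : σ → MvPowerSeries τ R} (ha : ∀ s, constantCoeff (a s) = 0)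
    {g : MvPowerSeries σ R} {n : ℕ} (hg : n ≤ g.order) : n ≤ (subst a g).order := by
  refine le_trans ?_ (le_order_subst (hasSubst_of_constantCoeff_zero ha) g)
  calc (n : ℕ∞) ≤ 1 * g.order := by rwa [one_mul]
    _ ≤ _ := by
      gcongr
      exact le_iInf fun s => one_le_order_iff_constCoeff_eq_zero.2 (ha s)

omit [Fintype σ] in
theorem le_order_pderiv {g : MvPowerSeries σ R} {n : ℕ} (hg : (n + 1 : ℕ) ≤ g.order) (s : σ) :
    n ≤ (pderiv R s g).order := by
  refine le_order fun d hd => ?_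
  rw [coeff_pderiv, coeff_of_lt_order, zero_mul]
  refine lt_of_lt_of_le ?_ hg
  rw [map_add, Finsupp.degree_single]
  exact_mod_cast Nat.succ_lt_succ (by exact_mod_cast hd)

theorem pderiv_subst_coe (a : σ → MvPowerSeries τ R) (i : τ)
    (q : MvPolynomial σ R) :
    pderiv R i (subst a (q : MvPowerSeries σ R)) =
      ∑ s, subst a (pderiv R s (q : MvPowerSeries σ R)) * pderiv R i (a s) := by
  classical
  simp only [pderiv_coe, subst_coe]
  induction q using MvPolynomial.induction_on with
  | C r => simp [MvPowerSeries.algebraMap_apply]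
  | add p q hp hq => simp [hp, hq, add_mul, Finset.sum_add_distrib]
  | mul_X p s hp =>
    simp only [map_mul, MvPolynomial.aeval_X, Derivation.leibniz, hp, MvPolynomial.pderiv_X,
      smul_eq_mul, map_add, add_mul, Finset.sum_add_distrib, Finset.mul_sum]
    congr 1
    · rw [Finset.sum_eq_single s]
      · simp
      · intro t _ hts; simp [hts.symm]
      · simp
    · exact Finset.sum_congr rfl fun t _ => by ring

/-- The chain rule for formal partial derivatives. -/
theorem pderiv_subst {a : σ → MvPowerSeries τ R} (ha : ∀ s, constantCoeff (a s) = 0) (i : τ)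
    (f : MvPowerSeries σ R) :
    pderiv R i (subst a f) = ∑ s, subst a (pderiv R s f) * pderiv R i (a s) := by
  have hs : HasSubst a := hasSubst_of_constantCoeff_zero ha
  ext d
  -- A derivative lowers the order by one, so a remainder of order at least `d.degree + 2` does not
  -- affect the coefficient at `d`. This reduces the claim to polynomials.
  set q : MvPolynomial σ R := truncTotal (d.degree + 2) f with hq
  obtain ⟨g, hfg⟩ : ∃ g, f = (q : MvPowerSeries σ R) + g := ⟨f - q, by ring⟩
  have hg : ((d.degree + 1 + 1 : ℕ) : ℕ∞) ≤ g.order := le_order fun e he => by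
    have h1 := congrArg (coeff e) hfg
    rw [map_add, MvPolynomial.coeff_coe, hq,
      coeff_truncTotal _ (by exact_mod_cast he)] at h1
    simpa using h1
  have h1 : coeff d (pderiv R i (subst a g)) = 0 := by
    have := le_order_subst_of_le ha hg
    rw [coeff_pderiv, coeff_of_lt_order, zero_mul]
    refine lt_of_lt_of_le ?_ this
    rw [map_add, Finsupp.degree_single]
    exact_mod_cast Nat.lt_succ_self _
  have h2 : ∀ s, coeff d (subst a (pderiv R s g) * pderiv R i (a s)) = 0 := fun s => by
    refine coeff_of_lt_order (lt_of_lt_of_le ?_ (le_order_mul))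
    refine lt_of_lt_of_le ?_ (le_add_right (le_order_subst_of_le ha (le_order_pderiv hg s)))
    exact_mod_cast Nat.lt_succ_self _
  simp only [hfg, subst_add hs, map_add, add_mul, Finset.sum_add_distrib]
  rw [h1, pderiv_subst_coe, map_sum (coeff d), map_sum (coeff d), Finset.sum_eq_zero fun s _ => h2 s]

end ChainRule

/-! ### Formal groups: invariant differential, logarithm and multiplication series. -/

section FormalGroup

open MvPowerSeries

variable {R : Type*} [CommRing R] (F : FormalGroup R)

/-- The series `(∂F/∂X)(0, X)`. -/
noncomputable def partialAtZero : R⟦X⟧ :=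
  subst ![(0 : R⟦X⟧), PowerSeries.X] (pderiv R (0 : Fin 2) F.toPowerSeries)

/-- This is the invariance of the differential. Differentiate `F(F(X, Y), Z) = F(X, F(Y, Z))` in `X`
and set `X = 0`, using `F(0, Y) = Y`; then rename `Y, Z` as the two variables of `F`. -/
theorem pderiv_mul_subst_partialAtZero :
    pderiv R (0 : Fin 2) F.toPowerSeries * (partialAtZero F).subst (X 0 : MvPowerSeries (Fin 2) R) =
      (partialAtZero F).subst F.toPowerSeries := by
  have hF := F.zero_constantCoeff
  have hc1 : ∀ s, constantCoeff ((![X 0, X 1] : Fin 2 → MvPowerSeries (Fin 3) R) s) = 0 := by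
    intro s; fin_cases s <;> simp
  have hc2 : ∀ s, constantCoeff ((![X 1, X 2] : Fin 2 → MvPowerSeries (Fin 3) R) s) = 0 := by
    intro s; fin_cases s <;> simp
  have hF1 := constantCoeff_subst_eq_zero (hasSubst_of_constantCoeff_zero hc1) hc1 hF
  have hF2 := constantCoeff_subst_eq_zero (hasSubst_of_constantCoeff_zero hc2) hc2 hF
  have hc3 : ∀ s, constantCoeff ((![subst ![X 0, X 1] F.toPowerSeries, X 2] :
      Fin 2 → MvPowerSeries (Fin 3) R) s) = 0 := by
    intro s; fin_cases s
    · exact hF1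
    · simp
  have hc4 : ∀ s, constantCoeff ((![X 0, subst ![X 1, X 2] F.toPowerSeries] :
      Fin 2 → MvPowerSeries (Fin 3) R) s) = 0 := by
    intro s; fin_cases s
    · simp
    · exact hF2
  have key := congrArg (pderiv R (0 : Fin 3)) F.assoc
  rw [pderiv_subst hc3, pderiv_subst hc4] at key
  simp only [Fin.sum_univ_two, Matrix.cons_val_zero, Matrix.cons_val_one, pderiv_subst hc1,
    pderiv_subst hc2, pderiv_X_self, mul_one, mul_zero, add_zero,
    pderiv_X_of_ne (R := R) (show (1 : Fin 3) ≠ 0 by decide),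
    pderiv_X_of_ne (R := R) (show (2 : Fin 3) ≠ 0 by decide)] at key
  have hb : HasSubst (![0, X 0, X 1] : Fin 3 → MvPowerSeries (Fin 2) R) :=
    hasSubst_of_constantCoeff_zero (by intro s; fin_cases s <;> simp)
  have key2 := congrArg (subst (![0, X 0, X 1] : Fin 3 → MvPowerSeries (Fin 2) R)) key
  have hX : (![X 0, X 1] : Fin 2 → MvPowerSeries (Fin 2) R) = X := by
    ext1 s; fin_cases s <;> rfl
  rw [subst_mul hb, subst_comp_subst_apply (hasSubst_of_constantCoeff_zero hc3) hb,
    subst_comp_subst_apply (hasSubst_of_constantCoeff_zero hc4) hb,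
    subst_comp_subst_apply (hasSubst_of_constantCoeff_zero hc1) hb] at key2
  have e1 : (fun s => subst (![0, X 0, X 1] : Fin 3 → MvPowerSeries (Fin 2) R)
      ((![X 0, X 1] : Fin 2 → MvPowerSeries (Fin 3) R) s)) = ![0, X 0] := by
    ext1 s; fin_cases s <;> simp [subst_X hb]
  have e2 : (fun s => subst (![0, X 0, X 1] : Fin 3 → MvPowerSeries (Fin 2) R)
      ((![X 1, X 2] : Fin 2 → MvPowerSeries (Fin 3) R) s)) = X := by
    ext1 s; fin_cases s <;> simp [subst_X hb]
  have e3 : (fun s => subst (![0, X 0, X 1] : Fin 3 → MvPowerSeries (Fin 2) R)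
      ((![subst ![X 0, X 1] F.toPowerSeries, X 2] :
      Fin 2 → MvPowerSeries (Fin 3) R) s)) = X := by
    ext1 s; fin_cases s
    · simp [subst_comp_subst_apply (hasSubst_of_constantCoeff_zero hc1) hb, e1]
      exact F.zero_add (PowerSeries.HasSubst.X 0)
    · simp [subst_X hb]
  have e4 : (fun s => subst (![0, X 0, X 1] : Fin 3 → MvPowerSeries (Fin 2) R)
      ((![X 0, subst ![X 1, X 2] F.toPowerSeries] :
      Fin 2 → MvPowerSeries (Fin 3) R) s)) = ![0, F.toPowerSeries] := by
    ext1 s; fin_cases s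
    · simp [subst_X hb]
    · simp [subst_comp_subst_apply (hasSubst_of_constantCoeff_zero hc2) hb, e2, subst_self]
  rw [e1, e3, e4, subst_self, id] at key2
  have hzX : HasSubst (![0, PowerSeries.X] : Fin 2 → R⟦X⟧) := HasSubst.zero_X
  have e5 : ∀ {g : MvPowerSeries (Fin 2) R}, constantCoeff g = 0 →
      (partialAtZero F).subst g = subst ![0, g] (pderiv R (0 : Fin 2) F.toPowerSeries) := by
    intro g hg
    have hg' : PowerSeries.HasSubst g := PowerSeries.HasSubst.of_constantCoeff_zero hg
    rw [partialAtZero, PowerSeries.subst, subst_comp_subst_apply hzX hg'.const]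
    congr! 1
    ext1 s; fin_cases s
    · simp [← PowerSeries.subst_def, ← PowerSeries.coe_substAlgHom hg']
    · simp [← PowerSeries.subst_def, PowerSeries.subst_X hg']
  rw [e5 (by simp), e5 hF]
  exact key2

/-- A primitive of the invariant differential is additive with respect to the formal group. -/
theorem subst_formalGroup_eq_add {K : Type*} [Field K] [CharZero K] (F : FormalGroup K) {L : K⟦X⟧}
    (hL0 : PowerSeries.constantCoeff L = 0)
    (hL : PowerSeries.derivative K L * partialAtZero F = 1) :
    L.subst F.toPowerSeries =
      L.subst (X 0 : MvPowerSeries (Fin 2) K) + L.subst (X 1 : MvPowerSeries (Fin 2) K) := by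
  have hF := F.zero_constantCoeff
  have chain : ∀ {g : MvPowerSeries (Fin 2) K}, constantCoeff g = 0 →
      pderiv K (0 : Fin 2) (L.subst g) =
        (PowerSeries.derivative K L).subst g * pderiv K (0 : Fin 2) g := by
    intro g hg
    have := pderiv_subst (a := fun _ : Unit => g) (fun _ => hg) (0 : Fin 2) L
    rwa [Fintype.sum_unique] at this
  have hone : ∀ {g : MvPowerSeries (Fin 2) K}, constantCoeff g = 0 →
      (PowerSeries.derivative K L).subst g * (partialAtZero F).subst g = 1 := by
    intro g hg
    have hg' : PowerSeries.HasSubst g := PowerSeries.HasSubst.of_constantCoeff_zero hg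
    rw [← PowerSeries.subst_mul hg', hL, ← PowerSeries.coe_substAlgHom hg', map_one]
  have hX0 := hone (g := X 0) (by simp)
  have hne : (partialAtZero F).subst (X 0 : MvPowerSeries (Fin 2) K) ≠ 0 := by
    intro h0; rw [h0, mul_zero] at hX0; exact zero_ne_one hX0
  rw [← sub_eq_zero]
  set G := L.subst F.toPowerSeries -
    (L.subst (X 0 : MvPowerSeries (Fin 2) K) + L.subst (X 1 : MvPowerSeries (Fin 2) K)) with hG
  -- The defect `G` of additivity has zero derivative in the first variable by invariance, and it
  -- vanishes when that variable is `0`. In characteristic zero these two facts force `G = 0`.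
  have hD : pderiv K (0 : Fin 2) G = 0 := by
    rw [hG, map_sub, map_add, chain hF, chain (by simp), chain (by simp), pderiv_X_self,
      pderiv_X_of_ne (show (1 : Fin 2) ≠ 0 by decide), mul_one, mul_zero, add_zero, sub_eq_zero]
    refine mul_right_cancel₀ hne ?_
    rw [hX0, mul_assoc, pderiv_mul_subst_partialAtZero, hone hF]
  have hres : rescale ![(0 : K), 1] G = 0 := by
    have hb : HasSubst ((![(0 : K), 1] : Fin 2 → K) • (X : Fin 2 → MvPowerSeries (Fin 2) K)) :=
      HasSubst.smul_X _
    have hb' : (![(0 : K), 1] : Fin 2 → K) • (X : Fin 2 → MvPowerSeries (Fin 2) K) = ![0, X 1] := by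
      ext1 s; fin_cases s <;> simp
    rw [hb'] at hb
    have hF' : PowerSeries.HasSubst F.toPowerSeries := PowerSeries.HasSubst.of_constantCoeff_zero hF
    rw [rescale_eq_subst, hb', hG, subst_sub hb, subst_add hb, PowerSeries.subst, PowerSeries.subst,
      PowerSeries.subst, subst_comp_subst_apply hF'.const hb,
      subst_comp_subst_apply (PowerSeries.HasSubst.X 0).const hb,
      subst_comp_subst_apply (PowerSeries.HasSubst.X 1).const hb, subst_X hb, subst_X hb]
    simp only [Matrix.cons_val_zero, Matrix.cons_val_one]
    have h0 : PowerSeries.subst (0 : MvPowerSeries (Fin 2) K) L = 0 :=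
      PowerSeries.subst_zero_of_constantCoeff_zero hL0
    rw [PowerSeries.subst] at h0
    rw [sub_eq_zero, h0, zero_add, F.zero_add (PowerSeries.HasSubst.X 1)]
  ext n
  rw [map_zero]
  rcases Nat.eq_zero_or_pos (n 0) with h0 | h0
  · have := congrArg (coeff n) hres
    rw [coeff_rescale, map_zero] at this
    simpa [Finsupp.prod_fintype, h0] using this
  · have hle : Finsupp.single 0 1 ≤ n := by
      rw [Finsupp.single_le_iff]; exact h0
    have := congrArg (coeff (n - Finsupp.single 0 1)) hD
    rw [coeff_pderiv, map_zero (coeff _), tsub_add_cancel_of_le hle] at this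
    exact (mul_eq_zero.1 this).resolve_right (Nat.cast_add_one_ne_zero _)

theorem constantCoeff_pair_eq_zero {σ : Type*} {a b : MvPowerSeries σ R}
    (ha : constantCoeff a = 0) (hb : constantCoeff b = 0) (s : Fin 2) :
    constantCoeff ((![a, b] : Fin 2 → MvPowerSeries σ R) s) = 0 := by
  fin_cases s <;> simpa

theorem constantCoeff_mulSeries (n : ℕ) : PowerSeries.constantCoeff (mulSeries F n) = 0 := by
  induction n with
  | zero => simp [mulSeries]
  | succ n ih =>
    have h := constantCoeff_pair_eq_zero ih (PowerSeries.constantCoeff_X (R := R))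
    exact constantCoeff_subst_eq_zero (hasSubst_of_constantCoeff_zero h) h F.zero_constantCoeff

theorem hasSubst_mulSeries (n : ℕ) : PowerSeries.HasSubst (mulSeries F n) :=
  PowerSeries.HasSubst.of_constantCoeff_zero' (constantCoeff_mulSeries F n)

theorem mulSeries_one : mulSeries F 1 = PowerSeries.X := F.zeroX_eq_X

theorem hasSubst_pair {σ : Type*} {a b : MvPowerSeries σ R}
    (ha : PowerSeries.HasSubst a) (hb : PowerSeries.HasSubst b) : HasSubst ![a, b] :=
  hasSubst_of_constantCoeff_nilpotent fun s => by fin_cases s <;> simpa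

theorem subst_mulSeries_mulSeries (m n : ℕ) :
    subst ![mulSeries F m, mulSeries F n] F.toPowerSeries = mulSeries F (m + n) := by
  induction n with
  | zero => exact F.add_zero (hasSubst_mulSeries F m)
  | succ n ih =>
    rw [← add_assoc, mulSeries, mulSeries, ← ih]
    exact (F.assoc' (hasSubst_mulSeries F m) (hasSubst_mulSeries F n)
      PowerSeries.HasSubst.X').symm

/-- Substitution of a one-variable series into `F(a, b)`. -/
theorem subst_subst_pair (F : MvPowerSeries (Fin 2) R) {a b g : R⟦X⟧}
    (ha : PowerSeries.HasSubst a) (hb : PowerSeries.HasSubst b) (hg : PowerSeries.HasSubst g) :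
    PowerSeries.subst g (subst ![a, b] F : R⟦X⟧) = subst ![a.subst g, b.subst g] F := by
  rw [PowerSeries.subst, subst_comp_subst_apply (hasSubst_pair ha hb) hg.const]
  congr! 1
  ext1 s; fin_cases s <;> rfl

theorem mulSeries_subst_mulSeries (m n : ℕ) :
    (mulSeries F m).subst (mulSeries F n) = mulSeries F (m * n) := by
  have hn := hasSubst_mulSeries F n
  induction m with
  | zero => rw [zero_mul, mulSeries, ← PowerSeries.coe_substAlgHom hn, map_zero]
  | succ m ih =>
    rw [mulSeries, subst_subst_pair _ (hasSubst_mulSeries F m) PowerSeries.HasSubst.X' hn, ih,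
      PowerSeries.subst_X hn, subst_mulSeries_mulSeries, Nat.succ_mul]

theorem map_subst_pair {S σ : Type*} [CommRing S] (φ : R →+* S) (G : MvPowerSeries (Fin 2) R)
    {a b : MvPowerSeries σ R} (ha : PowerSeries.HasSubst a) (hb : PowerSeries.HasSubst b) :
    MvPowerSeries.map φ (subst ![a, b] G) =
      subst ![MvPowerSeries.map φ a, MvPowerSeries.map φ b] (MvPowerSeries.map φ G) := by
  rw [map_subst (hasSubst_pair ha hb)]
  congr! 1
  ext1 s; fin_cases s <;> rfl

theorem map_mulSeries {S : Type*} [CommRing S] (φ : R →+* S) (n : ℕ) :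
    (mulSeries F n).map φ = mulSeries (F.map φ) n := by
  induction n with
  | zero => simp [mulSeries]
  | succ n ih =>
    have hX : MvPowerSeries.map φ (PowerSeries.X : R⟦X⟧) = (PowerSeries.X : S⟦X⟧) :=
      PowerSeries.map_X φ
    rw [mulSeries, mulSeries, ← ih, FormalGroup.map_toPowerSeries]
    refine (map_subst_pair φ F.toPowerSeries (hasSubst_mulSeries F n)
      PowerSeries.HasSubst.X').trans ?_
    rw [hX]; rfl

theorem map_partialAtZero {S : Type*} [CommRing S] (φ : R →+* S) :
    (partialAtZero F).map φ = partialAtZero (F.map φ) := by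
  have hX : MvPowerSeries.map φ (PowerSeries.X : R⟦X⟧) = (PowerSeries.X : S⟦X⟧) :=
    PowerSeries.map_X φ
  have hD : MvPowerSeries.map φ (pderiv R (0 : Fin 2) F.toPowerSeries) =
      pderiv S (0 : Fin 2) (F.map φ).toPowerSeries := by
    ext n; simp [coeff_pderiv]
  refine (map_subst_pair φ _ PowerSeries.HasSubst.zero' PowerSeries.HasSubst.X').trans ?_
  rw [hX, hD, map_zero]; rfl

/-- The logarithm turns multiplication by `n` in the formal group into multiplication by `n`. -/
theorem subst_mulSeries_eq_smul {K : Type*} [Field K] [CharZero K] (F : FormalGroup K) {L : K⟦X⟧}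
    (hL0 : PowerSeries.constantCoeff L = 0)
    (hL : PowerSeries.derivative K L * partialAtZero F = 1) (n : ℕ) :
    L.subst (mulSeries F n) = n • L := by
  induction n with
  | zero => rw [mulSeries, zero_smul]; exact PowerSeries.subst_zero_of_constantCoeff_zero hL0
  | succ n ih =>
    have hb := hasSubst_pair (hasSubst_mulSeries F n) (PowerSeries.HasSubst.X' (R := K))
    have h := congrArg (subst ![mulSeries F n, PowerSeries.X]) (subst_formalGroup_eq_add F hL0 hL)
    have hF' := PowerSeries.HasSubst.of_constantCoeff_zero F.zero_constantCoeff
    rw [subst_add hb, PowerSeries.subst, PowerSeries.subst, PowerSeries.subst,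
      subst_comp_subst_apply hF'.const hb,
      subst_comp_subst_apply (PowerSeries.HasSubst.X 0).const hb,
      subst_comp_subst_apply (PowerSeries.HasSubst.X 1).const hb, subst_X hb, subst_X hb] at h
    rw [mulSeries, succ_nsmul, ← ih]
    refine h.trans ?_
    congr 1
    exact PowerSeries.X_subst L

theorem constantCoeff_subst_of_constantCoeff_zero {f g : R⟦X⟧}
    (hg : PowerSeries.constantCoeff g = 0) :
    PowerSeries.constantCoeff (f.subst g) = PowerSeries.constantCoeff f := by
  have hg' : PowerSeries.HasSubst g := PowerSeries.HasSubst.of_constantCoeff_zero' hg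
  have h := PowerSeries.constantCoeff_subst_eq_zero hg (f - PowerSeries.C (PowerSeries.constantCoeff f))
    (by simp)
  rw [PowerSeries.subst_sub hg', PowerSeries.subst_C] at h
  rw [map_sub, sub_eq_zero] at h
  exact h.trans (MvPowerSeries.constantCoeff_C _)

/-- Compare linear terms in `L ∘ [n] = n L`, where `L` has nonzero linear term. -/
theorem coeff_one_mulSeries {K : Type*} [Field K] [CharZero K] (F : FormalGroup K) {L : K⟦X⟧}
    (hL0 : PowerSeries.constantCoeff L = 0)
    (hL : PowerSeries.derivative K L * partialAtZero F = 1) (n : ℕ) :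
    PowerSeries.coeff 1 (mulSeries F n) = n := by
  have h := congrArg (fun f => PowerSeries.constantCoeff (PowerSeries.derivative K f))
    (subst_mulSeries_eq_smul F hL0 hL n)
  have hne : PowerSeries.constantCoeff (PowerSeries.derivative K L) ≠ 0 := by
    intro h0
    have := congrArg PowerSeries.constantCoeff hL
    rw [map_mul, h0, zero_mul, map_one] at this
    exact zero_ne_one this
  simp only [PowerSeries.derivative_subst (hasSubst_mulSeries F n), map_mul, map_nsmul,
    constantCoeff_subst_of_constantCoeff_zero (constantCoeff_mulSeries F n)] at h
  rw [nsmul_eq_mul] at h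
  have h2 := mul_right_cancel₀ hne ((mul_comm _ _).trans h)
  rw [← h2, ← PowerSeries.coeff_zero_eq_constantCoeff_apply, PowerSeries.coeff_derivative]
  simp

end FormalGroup

/-- Let `t` tend to `1`. This recovers a bound on the full disk from bounds on smaller ones. -/
theorem le_of_forall_mul_pow_le {A M r : ℝ} (d : ℕ) (hr : r < 1)
    (h : ∀ t : ℝ, 0 ≤ t → r < t → t < 1 → A * t ^ d ≤ M) : A ≤ M := by
  have hlim : Filter.Tendsto (fun t : ℝ => A * t ^ d) (nhdsWithin 1 (Set.Iio 1)) (nhds A) := by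
    have : Filter.Tendsto (fun t : ℝ => A * t ^ d) (nhds 1) (nhds (A * 1 ^ d)) :=
      (continuous_const.mul (continuous_pow d)).tendsto 1
    rw [one_pow, mul_one] at this
    exact this.mono_left nhdsWithin_le_nhds
  refine le_of_tendsto hlim ?_
  filter_upwards [self_mem_nhdsWithin, nhdsWithin_le_nhds (lt_mem_nhds hr),
    nhdsWithin_le_nhds (lt_mem_nhds (zero_lt_one (α := ℝ)))] with t h1 h2 h3
  exact h t (le_of_lt h3) h2 h1

/-! ### The completed algebraic closure and bounds for coefficients by values. -/

section CompletedClosure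

universe u

variable {K : Type u} [NontriviallyNormedField K] [IsUltrametricDist K] [CompleteSpace K]

instance : IsUltrametricDist (AlgCl K) :=
  IsUltrametricDist.isUltrametricDist_of_isNonarchimedean_norm
    (isNonarchimedean_spectralNorm (K := K) (L := AlgebraicClosure K))

instance : IsUltrametricDist (Cp K) :=
  IsUltrametricDist.isUltrametricDist_of_forall_norm_add_le_max_norm fun x y => by
    induction x, y using UniformSpace.Completion.induction_on₂ with
    | hp => exact isClosed_le (by fun_prop) (by fun_prop)
    | ih x y =>
      rw [← UniformSpace.Completion.coe_add]
      simp only [UniformSpace.Completion.norm_coe]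
      exact IsUltrametricDist.norm_add_le_max x y

theorem norm_toCp (x : K) : ‖toCp K x‖ = ‖x‖ :=
  (UniformSpace.Completion.norm_coe (E := AlgCl K) _).trans
    (spectralNorm_extends (L := AlgebraicClosure K) x)

theorem eval_eq_ev (f : K⟦X⟧) (z : Cp K) : eval f z = ev (f.map (toCp K)) z := by
  simp only [eval, ev, PowerSeries.coeff_map]

/-- The completed algebraic closure contains finite extensions of `K`, with discrete norm, having
elements of norm arbitrarily close to `1`. -/
theorem exists_ramified_extension {p : ℕ} (hp : ‖(p : K)‖ < 1) (hp0 : (p : K) ≠ 0)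
    (hgap : ∃ c : ℝ, c < 1 ∧ ∀ x : K, ‖x‖ < 1 → ‖x‖ ≤ c) {r : ℝ} (hr : r < 1) :
    ∃ (E : Type u) (_ : NontriviallyNormedField E) (_ : IsUltrametricDist E) (_ : CompleteSpace E)
      (ι : K →+* E) (φ : E →+* Cp K) (a : E), φ.comp ι = toCp K ∧ (∀ x, ‖φ x‖ = ‖x‖) ∧
      (∃ c : ℝ, c < 1 ∧ ∀ x : E, ‖x‖ < 1 → ‖x‖ ≤ c) ∧
      (∀ P : Polynomial E, (P.map φ).Splits) ∧ r < ‖a‖ ∧ ‖a‖ < 1 := by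
  have hpn : 0 < ‖(p : K)‖ := norm_pos_iff.2 hp0
  -- An `m`-th root of `p` has norm above `r` as soon as `r ^ m < ‖p‖`; adjoining one root is
  -- enough.
  obtain ⟨m, hm⟩ := exists_pow_lt_of_lt_one hpn hr
  have hm0 : m ≠ 0 := by rintro rfl; rw [pow_zero] at hm; linarith
  obtain ⟨b, hb⟩ := IsAlgClosed.exists_pow_nat_eq (algebraMap K (AlgebraicClosure K) p)
    (Nat.pos_of_ne_zero hm0)
  let E := IntermediateField.adjoin K {b}
  have : FiniteDimensional K E :=
    IntermediateField.adjoin.finiteDimensional (Algebra.IsIntegral.isIntegral b)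
  let : NontriviallyNormedField E := spectralNorm.nontriviallyNormedField K E
  have hE : IsUltrametricDist E :=
    IsUltrametricDist.isUltrametricDist_of_isNonarchimedean_norm
      (isNonarchimedean_spectralNorm (K := K) (L := E))
  have hcomp : CompleteSpace E := spectralNorm.completeSpace K E
  let φ : E →+* Cp K := (UniformSpace.Completion.coeRingHom (α := AlgCl K)).comp
    (algebraMap E (AlgebraicClosure K) : E →+* AlgebraicClosure K)
  have hφ : ∀ x, ‖φ x‖ = ‖x‖ := fun x =>
    (UniformSpace.Completion.norm_coe (E := AlgCl K) _).trans
      (spectralNorm.eq_of_tower (K := K) (L := AlgebraicClosure K) x).symm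
  have ha : ‖(⟨b, IntermediateField.mem_adjoin_simple_self K b⟩ : E)‖ ^ m = ‖(p : K)‖ := by
    rw [← norm_pow]
    have : (⟨b, IntermediateField.mem_adjoin_simple_self K b⟩ : E) ^ m = algebraMap K E p :=
      Subtype.ext hb
    rw [this]
    exact spectralNorm_extends (L := E) (p : K)
  refine ⟨E, inferInstance, hE, hcomp, algebraMap K E, φ,
    ⟨b, IntermediateField.mem_adjoin_simple_self K b⟩, rfl, hφ, ?_, fun P => ?_, ?_, ?_⟩
  · obtain ⟨c, hc1, hc⟩ := hgap
    refine exists_gap_of_finite (k := K) (E := E) hc1 fun x => ?_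
    rw [show ‖algebraMap K E x‖ = ‖x‖ from spectralNorm_extends (L := E) x]
    exact hc x
  · obtain ⟨ψ, hψ⟩ : ∃ ψ : AlgebraicClosure K →+* Cp K,
        φ = ψ.comp (algebraMap E (AlgebraicClosure K)) :=
      ⟨UniformSpace.Completion.coeRingHom (α := AlgCl K), rfl⟩
    rw [hψ, ← Polynomial.map_map]
    exact (IsAlgClosed.splits _).map ψ
  · exact lt_of_pow_lt_pow_left₀ m (norm_nonneg _) (by rw [ha]; exact hm)
  · exact lt_of_pow_lt_pow_left₀ m zero_le_one (by rw [ha, one_pow]; exact hp)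

theorem exists_norm_between {p : ℕ} (hp : ‖(p : K)‖ < 1) (hp0 : (p : K) ≠ 0)
    (hgap : ∃ c : ℝ, c < 1 ∧ ∀ x : K, ‖x‖ < 1 → ‖x‖ ≤ c) {r : ℝ} (hr : r < 1) :
    ∃ z : Cp K, r < ‖z‖ ∧ ‖z‖ < 1 := by
  obtain ⟨E, _, _, _, ι, φ, a, -, hφ, -, -, h1, h2⟩ :=
    exists_ramified_extension hp hp0 hgap (max_lt hr one_pos)
  exact ⟨φ a, by rw [hφ]; exact (le_max_left r 0).trans_lt h1, by rwa [hφ]⟩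

/-- Convergence at one point `z` with `r < ‖z‖ < 1` bounds the terms at radius `r`, and such points
exist because roots of `p` have norms accumulating at `1`. -/
theorem HolomorphicOnDisk.convOnDisk {p : ℕ} (hp : ‖(p : K)‖ < 1) (hp0 : (p : K) ≠ 0)
    (hgap : ∃ c : ℝ, c < 1 ∧ ∀ x : K, ‖x‖ < 1 → ‖x‖ ≤ c) {f : K⟦X⟧} (hf : HolomorphicOnDisk f) :
    ConvOnDisk f := by
  refine convOnDisk_of_bounded fun r hr hr1 => ?_
  obtain ⟨z, hz, hz1⟩ := exists_norm_between hp hp0 hgap hr1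
  obtain ⟨M, hM⟩ := (hf z hz1).tendsto_atTop_zero.norm.bddAbove_range
  refine ⟨M, fun n => ?_⟩
  calc ‖PowerSeries.coeff n f‖ * r ^ n ≤ ‖PowerSeries.coeff n f‖ * ‖z‖ ^ n := by gcongr
    _ = ‖toCp K (PowerSeries.coeff n f) * z ^ n‖ := by rw [norm_mul, norm_pow, norm_toCp]
    _ ≤ M := hM ⟨n, rfl⟩

theorem ConvOnDisk.map {E C : Type*} [NormedField E] [NormedField C] {φ : E →+* C}
    (hφ : ∀ x, ‖φ x‖ = ‖x‖) {f : E⟦X⟧} (hf : ConvOnDisk f) : ConvOnDisk (f.map φ) := by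
  simpa only [ConvOnDisk, PowerSeries.coeff_map, hφ] using hf

theorem ConvOnDisk.holomorphicOnDisk {f : K⟦X⟧} (hf : ConvOnDisk f) : HolomorphicOnDisk f :=
  fun z hz => by
    simpa only [PowerSeries.coeff_map] using (hf.map (φ := toCp K) norm_toCp).summable hz

/-- A series such as the logarithm may have unbounded coefficients, but `f(aX)` does not; this is
how Weierstrass preparation becomes applicable. -/
theorem ConvOnDisk.exists_bound_rescale {E : Type*} [NormedField E] {f : E⟦X⟧} (hf : ConvOnDisk f)
    {a : E} (ha : ‖a‖ < 1) :
    ∃ M, ∀ n, ‖PowerSeries.coeff n (PowerSeries.rescale a f)‖ ≤ M := by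
  obtain ⟨M, hM⟩ := (hf ‖a‖ (norm_nonneg a) ha).tendsto_atTop_zero.bddAbove_range
  refine ⟨M, fun n => ?_⟩
  rw [PowerSeries.coeff_rescale, norm_mul, norm_pow, mul_comm]
  exact hM ⟨n, rfl⟩

theorem map_rescale {E C : Type*} [CommRing E] [CommRing C] (φ : E →+* C) (a : E) (f : E⟦X⟧) :
    (PowerSeries.rescale a f).map φ = PowerSeries.rescale (φ a) (f.map φ) := by
  ext n; simp [PowerSeries.coeff_rescale]

/-- A series which is bounded by `M` near the boundary of the unit disk has its coefficients bounded
by `M`. -/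
theorem norm_coeff_le_of_norm_ev_le {p : ℕ} (hp : ‖(p : K)‖ < 1) (hp0 : (p : K) ≠ 0)
    (hgap : ∃ c : ℝ, c < 1 ∧ ∀ x : K, ‖x‖ < 1 → ‖x‖ ≤ c) {g : K⟦X⟧} (hg : ConvOnDisk g)
    {r M : ℝ} (hr : r < 1) (hM : ∀ z : Cp K, r < ‖z‖ → ‖z‖ < 1 → ‖ev (g.map (toCp K)) z‖ ≤ M)
    (n : ℕ) : ‖PowerSeries.coeff n g‖ ≤ M := by
  have hM0 : 0 ≤ M := by
    obtain ⟨z, hz, hz1⟩ := exists_norm_between hp hp0 hgap hr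
    exact (norm_nonneg _).trans (hM z hz hz1)
  rcases eq_or_ne g 0 with rfl | hg0
  · simpa using hM0
  refine le_of_forall_mul_pow_le n hr fun t ht0 hrt ht1 => ?_
  obtain ⟨E, _, _, _, ι, φ, a, hφι, hφ, ⟨c, hc1, hc⟩, -, hta, ha1⟩ :=
    exists_ramified_extension hp hp0 hgap ht1
  have hι : ∀ x, ‖ι x‖ = ‖x‖ := fun x => by
    rw [← hφ, ← RingHom.comp_apply, hφι, norm_toCp]
  have ha0 : a ≠ 0 := norm_pos_iff.1 (ht0.trans_lt hta)
  obtain ⟨B, hB⟩ := (hg.map hι).exists_bound_rescale ha1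
  have hne : PowerSeries.rescale a (g.map ι) ≠ 0 := by
    intro h0
    refine hg0 (PowerSeries.ext fun m => ι.injective ?_)
    have := congrArg (PowerSeries.coeff m) h0
    rw [PowerSeries.coeff_rescale, PowerSeries.coeff_map, map_zero] at this
    rw [map_zero, map_zero]
    exact (mul_eq_zero.1 this).resolve_left (pow_ne_zero m ha0)
  obtain ⟨s, d, ρ, hs, hle, hρ, hev⟩ := exists_norm_ev_eq hφ hc1 hc hne hB
  have hsM : ‖s‖ ≤ M := by
    have ha' : 0 < ‖a‖ := norm_pos_iff.2 ha0
    -- For `‖w‖` above `ρ` the value of the rescaled series has norm exactly `‖s‖ * ‖w‖ ^ d`; for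
    -- `‖w‖` above `r / ‖a‖` the point `φ a * w` lies in the annulus where the bound `M` holds.
    refine le_of_forall_mul_pow_le d (max_lt hρ ((div_lt_one ha').2 (hrt.trans hta)))
      fun t' ht'0 hlt ht'1 => ?_
    obtain ⟨w, hw, hw1⟩ := exists_norm_between hp hp0 hgap ht'1
    have h1 := hev w ((le_max_left _ _).trans_lt (hlt.trans hw)) hw1
    have h2 : r < ‖φ a * w‖ := by
      rw [norm_mul, hφ, ← div_lt_iff₀' ha']
      exact (le_max_right _ _).trans_lt (hlt.trans hw)
    have h3 : ‖φ a * w‖ < 1 := by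
      rw [norm_mul, hφ]
      exact (mul_le_of_le_one_left (norm_nonneg _) ha1.le).trans_lt hw1
    have h4 := hM _ h2 h3
    rw [← ev_rescale, ← hφι, PowerSeries.map_comp, RingHom.comp_apply, ← map_rescale, h1] at h4
    refine le_trans ?_ h4
    gcongr
  calc ‖PowerSeries.coeff n g‖ * t ^ n ≤ ‖PowerSeries.coeff n g‖ * ‖a‖ ^ n := by gcongr
    _ = ‖PowerSeries.coeff n (PowerSeries.rescale a (g.map ι))‖ := by
      rw [PowerSeries.coeff_rescale, norm_mul, norm_pow, PowerSeries.coeff_map, hι, mul_comm]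
    _ ≤ M := (hle n).trans hsM

end CompletedClosure

/-! ### Zeros of the logarithm and torsion points. -/

section LogarithmZeros

variable {C : Type*} [NormedField C] [IsUltrametricDist C] [CompleteSpace C]

/-- A series `X + ⋯` has no zero near the origin except the origin. -/
theorem exists_zero_free_disk {L : C⟦X⟧} (hL : ConvOnDisk L) (hL0 : PowerSeries.coeff 0 L = 0)
    (hL1 : PowerSeries.coeff 1 L = 1) : ∃ δ > 0, ∀ w : C, ‖w‖ < δ → ev L w = 0 → w = 0 := by
  obtain ⟨M, hM⟩ := (hL (1 / 2) (by norm_num) (by norm_num)).tendsto_atTop_zero.bddAbove_range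
  have hM : ∀ n, ‖PowerSeries.coeff n L‖ * (1 / 2) ^ n ≤ M := fun n => hM ⟨n, rfl⟩
  have hM0 : 0 ≤ M := (mul_nonneg (norm_nonneg _) (by positivity)).trans (hM 0)
  -- The terms of degree at least `2` are bounded by `M * (2 * ‖w‖) ^ 2`, which is below `‖w‖` for
  -- this radius, so the linear term cannot be cancelled.
  refine ⟨min (1 / 2) (1 / (4 * (M + 1))), by positivity, fun w hw h0 => ?_⟩
  by_contra hne
  have hw0 : 0 < ‖w‖ := norm_pos_iff.2 hne
  have hw1 : ‖w‖ < 1 / 2 := hw.trans_le (min_le_left _ _)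
  have hw2 : 4 * (M + 1) * ‖w‖ < 1 := by
    have := hw.trans_le (min_le_right _ _)
    rwa [lt_div_iff₀' (by positivity)] at this
  have hdec : L = PowerSeries.X + (L - PowerSeries.X) := by ring
  have hX : ConvOnDisk (PowerSeries.X : C⟦X⟧) := by
    simpa using convOnDisk_coe (Polynomial.X : Polynomial C)
  have hT : ConvOnDisk (L - PowerSeries.X) := by
    have := hL.add (convOnDisk_coe (-Polynomial.X : Polynomial C))
    simpa [← sub_eq_add_neg] using this
  have hlt : ‖ev (L - PowerSeries.X) w‖ < ‖w‖ := by
    refine lt_of_le_of_lt (b := M * (2 * ‖w‖) ^ 2) (norm_ev_le fun n => ?_) ?_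
    · rcases n with _ | _ | n
      · rw [map_sub, hL0, PowerSeries.coeff_zero_X, sub_zero, norm_zero, zero_mul]; positivity
      · simp [hL1]; positivity
      · rw [map_sub, PowerSeries.coeff_X, if_neg (by omega), sub_zero]
        calc ‖PowerSeries.coeff (n + 1 + 1) L‖ * ‖w‖ ^ (n + 1 + 1)
            = ‖PowerSeries.coeff (n + 1 + 1) L‖ * (1 / 2) ^ (n + 1 + 1) *
              (2 * ‖w‖) ^ (n + 1 + 1) := by
              rw [mul_assoc, ← mul_pow]; congr 2; ring
          _ ≤ M * (2 * ‖w‖) ^ 2 := by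
              refine mul_le_mul (hM _) ?_ (by positivity) hM0
              exact pow_le_pow_of_le_one (by positivity) (by linarith) (by omega)
    · nlinarith
  have hXw : ev (PowerSeries.X : C⟦X⟧) w = w := by
    simpa using ev_coe (Polynomial.X : Polynomial C) w
  rw [hdec, ev_add hX hT (by linarith), hXw] at h0
  rw [eq_neg_of_add_eq_zero_right h0, norm_neg] at hlt
  exact lt_irrefl _ hlt

variable [CharZero C] {G : FormalGroup C} {L : C⟦X⟧}

theorem ev_mulSeries_log (hG : ∀ n, Integral (mulSeries G n)) (hL : ConvOnDisk L)
    (hL0 : PowerSeries.constantCoeff L = 0)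
    (hLd : PowerSeries.derivative C L * partialAtZero G = 1) (n : ℕ) {z : C} (hz : ‖z‖ < 1) :
    ev L (ev (mulSeries G n) z) = n * ev L z := by
  rw [← ev_subst hL (hG n) (constantCoeff_mulSeries G n) hz, subst_mulSeries_eq_smul G hL0 hLd,
    nsmul_eq_mul, ← map_natCast (PowerSeries.C (R := C)), ev_C_mul _ hL hz]

/-- The zeros of the logarithm in the open unit disk are the torsion points. -/
theorem ev_log_eq_zero_iff {p : ℕ} (hpr : p ≠ 0) (hp : ‖(p : C)‖ < 1)
    (hG : ∀ n, Integral (mulSeries G n)) (hL : ConvOnDisk L)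
    (hL0 : PowerSeries.constantCoeff L = 0) (hL1 : PowerSeries.coeff 1 L = 1)
    (hLd : PowerSeries.derivative C L * partialAtZero G = 1) {z : C} (hz : ‖z‖ < 1) :
    ev L z = 0 ↔ ∃ n : ℕ, 0 < n ∧ ev (mulSeries G n) z = 0 := by
  constructor
  · intro h
    obtain ⟨δ, hδ, hinj⟩ := exists_zero_free_disk hL (by simpa using hL0) hL1
    -- The linear coefficient of `[p]` is `p` and the others are integral. So `[p]` shrinks norms by
    -- a factor `ρ < 1` on the disk of radius `‖z‖`, and its iterates enter the zero-free disk.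
    have hstep : ∀ w : C, ‖w‖ < 1 → ‖ev (mulSeries G p) w‖ ≤ max ‖(p : C)‖ ‖w‖ * ‖w‖ := by
      intro w hw
      refine norm_ev_le fun n => ?_
      rcases n with _ | _ | n
      · rw [PowerSeries.coeff_zero_eq_constantCoeff, constantCoeff_mulSeries]
        simp; positivity
      · rw [zero_add, coeff_one_mulSeries G hL0 hLd, pow_one]
        gcongr; exact le_max_left _ _
      · calc _ ≤ 1 * ‖w‖ ^ (n + 1 + 1) := by gcongr; exact hG p _
          _ ≤ 1 * ‖w‖ ^ 2 := by
            gcongr 1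
            exact pow_le_pow_of_le_one (norm_nonneg w) hw.le (by omega)
          _ = ‖w‖ * ‖w‖ := by ring
          _ ≤ _ := by gcongr; exact le_max_right _ _
    set ρ := max ‖(p : C)‖ ‖z‖ with hρ
    have hρ1 : ρ < 1 := max_lt hp hz
    have hρ0 : 0 ≤ ρ := (norm_nonneg z).trans (le_max_right _ _)
    have hw : ∀ k, ‖ev (mulSeries G (p ^ k)) z‖ ≤ ρ ^ k * ‖z‖ := by
      intro k
      induction k with
      | zero =>
        have hX : ev (PowerSeries.X : C⟦X⟧) z = z := by
          simpa using ev_coe (Polynomial.X : Polynomial C) z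
        rw [pow_zero, mulSeries_one, hX]; simp
      | succ k ih =>
        have hle : ‖ev (mulSeries G (p ^ k)) z‖ ≤ ‖z‖ :=
          ih.trans (mul_le_of_le_one_left (norm_nonneg z) (pow_le_one₀ hρ0 hρ1.le))
        rw [pow_succ', ← mulSeries_subst_mulSeries, ev_subst (hG p).convOnDisk (hG _)
          (constantCoeff_mulSeries G _) hz]
        calc _ ≤ max ‖(p : C)‖ ‖ev (mulSeries G (p ^ k)) z‖ * ‖ev (mulSeries G (p ^ k)) z‖ :=
              hstep _ (hle.trans_lt hz)
          _ ≤ ρ * (ρ ^ k * ‖z‖) := by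
              refine mul_le_mul ?_ ih (norm_nonneg _) hρ0
              exact max_le_max le_rfl hle
          _ = _ := by ring
    have hlim : Filter.Tendsto (fun k => ρ ^ k * ‖z‖) Filter.atTop (nhds 0) := by
      simpa using (tendsto_pow_atTop_nhds_zero_of_lt_one hρ0 hρ1).mul_const ‖z‖
    obtain ⟨k, hk⟩ := (hlim.eventually (gt_mem_nhds hδ)).exists
    refine ⟨p ^ k, Nat.pow_pos (Nat.pos_of_ne_zero hpr), hinj _ ((hw k).trans_lt hk) ?_⟩
    rw [ev_mulSeries_log hG hL hL0 hLd _ hz, h, mul_zero]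
  · rintro ⟨n, hn, h⟩
    have := ev_mulSeries_log hG hL hL0 hLd n hz
    rw [h, ev_zero_right, hL0, eq_comm, mul_eq_zero] at this
    exact this.resolve_left (by exact_mod_cast hn.ne')

end LogarithmZeros

/-! ### The series `Log F`: coefficients, derivative and convergence. -/

section LogSeries

open MvPowerSeries in
theorem constantCoeff_partialAtZero {R : Type*} [CommRing R] (F : FormalGroup R) :
    PowerSeries.constantCoeff (partialAtZero F) = 1 := by
  have h := constantCoeff_pair_eq_zero (R := R) (a := (0 : R⟦X⟧)) (b := (PowerSeries.X : R⟦X⟧))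
    (map_zero _) (PowerSeries.constantCoeff_X)
  have hs := hasSubst_of_constantCoeff_zero h
  have hD : constantCoeff (pderiv R (0 : Fin 2) F.toPowerSeries) = 1 := by
    rw [← coeff_zero_eq_constantCoeff_apply, coeff_pderiv, zero_add, F.lin_coeff_X]; simp
  have h0 := constantCoeff_subst_eq_zero hs h
    (f := pderiv R (0 : Fin 2) F.toPowerSeries - C 1) (by rw [map_sub, hD]; simp)
  rw [subst_sub hs, subst_C, map_sub, sub_eq_zero, constantCoeff_C] at h0
  exact h0

theorem partialAtZero_mul_invDiff {R : Type*} [CommRing R] (F : FormalGroup R) :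
    partialAtZero F * invDiff F = 1 :=
  PowerSeries.mul_invOfUnit _ _ (by rw [Units.val_one]; exact constantCoeff_partialAtZero F)

theorem derivative_map {R S : Type*} [CommRing R] [CommRing S] (φ : R →+* S) (f : R⟦X⟧) :
    PowerSeries.derivative S (f.map φ) = (PowerSeries.derivative R f).map φ := by
  ext n; simp [PowerSeries.coeff_derivative]

variable {K : Type*} [NontriviallyNormedField K] [IsUltrametricDist K]
  (F : FormalGroup (Integers K))

theorem integral_map_algebraMap (f : (Integers K)⟦X⟧) :
    Integral (f.map (algebraMap (Integers K) K)) := fun n => by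
  rw [PowerSeries.coeff_map]; exact norm_le_one_of_integers _

theorem coeff_zero_log : PowerSeries.coeff 0 (Log F) = 0 := by
  rw [Log, PowerSeries.coeff_mk]

theorem coeff_succ_log (n : ℕ) : PowerSeries.coeff (n + 1) (Log F) =
    algebraMap (Integers K) K (PowerSeries.coeff n (invDiff F)) / ((n : K) + 1) := by
  rw [Log, PowerSeries.coeff_mk]

theorem coeff_one_log : PowerSeries.coeff 1 (Log F) = 1 := by
  have h : PowerSeries.constantCoeff (invDiff F) = 1 := by
    rw [invDiff, PowerSeries.constantCoeff_invOfUnit]; simp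
  rw [coeff_succ_log F 0, PowerSeries.coeff_zero_eq_constantCoeff, h]; simp

theorem derivative_log [CharZero K] :
    PowerSeries.derivative K (Log F) = (invDiff F).map (algebraMap (Integers K) K) := by
  ext n
  rw [PowerSeries.coeff_derivative, coeff_succ_log, PowerSeries.coeff_map,
    div_mul_cancel₀ _ (Nat.cast_add_one_ne_zero n)]

/-- The numerators are integral and the inverse norms of the denominators grow polynomially, which
`r ^ n` outweighs. -/
theorem convOnDisk_log {p : ℕ} [Fact p.Prime] (hp : ‖(p : K)‖ < 1) (hp0 : (p : K) ≠ 0) :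
    ConvOnDisk (Log F) := by
  obtain ⟨c, hc⟩ := exists_inv_norm_natCast_le hp hp0
  refine convOnDisk_of_bounded fun r hr hr1 => ?_
  obtain ⟨M, hM⟩ := (tendsto_pow_const_mul_const_pow_of_abs_lt_one c
    (abs_lt.2 ⟨by linarith, hr1⟩)).bddAbove_range
  refine ⟨max M 0, fun n => ?_⟩
  rcases n with _ | n
  · rw [coeff_zero_log]; simp
  · refine le_max_of_le_left (le_trans ?_ (hM ⟨n + 1, rfl⟩))
    dsimp only
    gcongr
    rw [coeff_succ_log, norm_div, div_eq_mul_inv]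
    refine (mul_le_of_le_one_left (by positivity) (norm_le_one_of_integers _)).trans ?_
    simpa using hc (n + 1) n.succ_ne_zero

theorem derivative_log_mul [CharZero K] : PowerSeries.derivative K (Log F) *
    partialAtZero (F.map (algebraMap (Integers K) K)) = 1 := by
  rw [derivative_log, ← map_partialAtZero, ← map_mul, mul_comm, partialAtZero_mul_invDiff, map_one]

end LogSeries

/-! ### The logarithm has the characterising properties. -/

section LogProperties

universe u

variable {K : Type u} [NontriviallyNormedField K] [IsUltrametricDist K] [CompleteSpace K]
  (F : FormalGroup (Integers K))

omit [CompleteSpace K] in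
theorem map_formalGroup_map {S T : Type*} [CommRing S] [CommRing T] (F : FormalGroup (Integers K))
    (φ : Integers K →+* S) (ψ : S →+* T) : (F.map φ).map ψ = F.map (ψ.comp φ) :=
  FormalGroup.ext (by ext n; simp)

theorem integral_mulSeries_map (n : ℕ) :
    Integral (mulSeries (F.map ((toCp K).comp (algebraMap (Integers K) K))) n) := by
  rw [← map_mulSeries, PowerSeries.map_comp]
  exact (integral_map_algebraMap _).map norm_toCp

theorem charZero_Cp [CharZero K] : CharZero (Cp K) :=
  charZero_of_injective_ringHom (toCp K).injective

theorem zeroSet_log {p : ℕ} [hpr : Fact p.Prime] [CharZero K] (hp : ‖(p : K)‖ < 1)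
    (hp0 : (p : K) ≠ 0) : zeroSet (Log F) = Tors F := by
  have := charZero_Cp (K := K)
  ext z
  refine and_congr_right fun hz => ?_
  simp only [eval_eq_ev]
  have hpC : ‖(p : Cp K)‖ < 1 := by rw [← map_natCast (toCp K), norm_toCp]; exact hp
  rw [ev_log_eq_zero_iff (G := F.map ((toCp K).comp (algebraMap (Integers K) K)))
    hpr.out.ne_zero hpC (integral_mulSeries_map F) ((convOnDisk_log F hp hp0).map norm_toCp)
    _ _ _ hz]
  · refine exists_congr fun n => and_congr_right fun _ => ?_
    rw [← map_mulSeries, PowerSeries.map_comp]; rfl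
  · rw [← PowerSeries.coeff_zero_eq_constantCoeff_apply, PowerSeries.coeff_map, coeff_zero_log,
      map_zero]
  · rw [PowerSeries.coeff_map, coeff_one_log, map_one]
  · rw [derivative_map, ← map_formalGroup_map, ← map_partialAtZero, ← map_mul, derivative_log_mul,
      map_one]

/-- The derivative is integral with constant term `1`, so it has norm `1` everywhere on the disk. -/
theorem isSimpleZero_log [CharZero K] {z : Cp K} (hz : z ∈ zeroSet (Log F)) :
    IsSimpleZero (Log F) z := by
  refine ⟨hz.2, ?_⟩
  rw [eval_eq_ev, derivative_log, ← norm_ne_zero_iff, norm_ev_eq_one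
    ((integral_map_algebraMap _).map norm_toCp) _ hz.1]
  · exact one_ne_zero
  · have h : PowerSeries.constantCoeff (invDiff F) = 1 := by
      rw [invDiff, PowerSeries.constantCoeff_invOfUnit]; simp
    rw [← PowerSeries.coeff_zero_eq_constantCoeff_apply, PowerSeries.coeff_map,
      PowerSeries.coeff_map, PowerSeries.coeff_zero_eq_constantCoeff_apply, h]
    simp

theorem boundedOnDisk_derivative_log [CharZero K] :
    BoundedOnDisk (PowerSeries.derivative K (Log F)) := by
  refine ⟨1, fun z hz => ?_⟩
  rw [eval_eq_ev, derivative_log]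
  exact norm_ev_le_of_coeff_le ((integral_map_algebraMap _).map norm_toCp) hz.le

end LogProperties

/-! ### Finite height makes the logarithm unbounded. -/

section Unbounded

/-- Write `f = X ^ m * f₁` with `f₁(0) ≠ 0`: the composite is `g ^ m` times a series with nonzero
constant term. -/
theorem subst_ne_zero {k : Type*} [Field k] {f g : k⟦X⟧} (hf : f ≠ 0) (hg : g ≠ 0)
    (hg0 : PowerSeries.constantCoeff g = 0) : f.subst g ≠ 0 := by
  have hgs : PowerSeries.HasSubst g := PowerSeries.HasSubst.of_constantCoeff_zero' hg0
  have h0 : PowerSeries.constantCoeff (f.divXPowOrder.subst g) ≠ 0 := by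
    rw [constantCoeff_subst_of_constantCoeff_zero hg0]
    exact mt PowerSeries.constantCoeff_divXPowOrder_eq_zero_iff.1 hf
  rw [← PowerSeries.X_pow_order_mul_divXPowOrder (f := f), PowerSeries.subst_mul hgs,
    PowerSeries.subst_pow hgs, PowerSeries.subst_X hgs]
  exact mul_ne_zero (pow_ne_zero _ hg) fun h => h0 (by rw [h, map_zero])

variable {K : Type*} [NontriviallyNormedField K] [IsUltrametricDist K]

/-- The logarithm of a formal group of finite height has unbounded coefficients. -/
theorem not_bounded_log [CharZero K] {p : ℕ} (hp : ‖(p : K)‖ < 1)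
    (hgap : ∃ c : ℝ, c < 1 ∧ ∀ x : K, ‖x‖ < 1 → ‖x‖ ≤ c) {F : FormalGroup (Integers K)}
    (hF : FiniteHeight p F) {M : ℝ} (hM : ∀ n, ‖PowerSeries.coeff n (Log F)‖ ≤ M) : False := by
  obtain ⟨c, hc1, hc⟩ := hgap
  obtain ⟨N, hN⟩ := exists_norm_max hc1 hc hM
  set s := PowerSeries.coeff N (Log F) with hs
  have hs1 : 0 < ‖s‖ := by
    have := hN 1
    rw [coeff_one_log, norm_one] at this
    exact one_pos.trans_le this
  have hs0 : s ≠ 0 := norm_pos_iff.1 hs1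
  -- Dividing by a coefficient of largest norm makes the series integral with `N`-th coefficient
  -- `1`, so its reduction is nonzero.
  set ℓ : (Integers K)⟦X⟧ := PowerSeries.mk fun n => ⟨s⁻¹ * PowerSeries.coeff n (Log F),
    mem_integers.2 (by rw [norm_mul, norm_inv, inv_mul_le_iff₀ hs1, mul_one]; exact hN n)⟩ with hℓ
  have hℓmap : ℓ.map (algebraMap (Integers K) K) = PowerSeries.C s⁻¹ * Log F := by
    ext n
    rw [PowerSeries.coeff_map, hℓ, PowerSeries.coeff_mk, PowerSeries.coeff_C_mul]; rfl
  have hinj : Function.Injective (PowerSeries.map (algebraMap (Integers K) K)) :=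
    PowerSeries.map_injective _ Subtype.val_injective
  have hsub := hasSubst_mulSeries F p
  have hlog : ℓ.subst (mulSeries F p) = p • ℓ := by
    refine hinj ?_
    have h1 := subst_mulSeries_eq_smul (F.map (algebraMap (Integers K) K)) (L := Log F)
      (by simpa using coeff_zero_log F) (derivative_log_mul F) p
    have h2 := hasSubst_mulSeries (F.map (algebraMap (Integers K) K)) p
    refine (PowerSeries.map_subst hsub ℓ).trans ?_
    rw [map_nsmul, hℓmap]
    change (PowerSeries.C s⁻¹ * Log F).subst
      ((mulSeries F p).map (algebraMap (Integers K) K)) = _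
    rw [map_mulSeries, ← PowerSeries.smul_eq_C_mul, PowerSeries.subst_smul h2, h1, smul_comm]
  have hres := congrArg (PowerSeries.map (IsLocalRing.residue (Integers K))) hlog
  have hp' : IsLocalRing.residue (Integers K) (p : Integers K) = 0 := by
    rw [IsLocalRing.residue_eq_zero_iff, mem_maximalIdeal_integers]
    simpa using hp
  have hright : (p • ℓ).map (IsLocalRing.residue (Integers K)) = 0 := by
    rw [nsmul_eq_mul, map_mul, map_natCast, ← map_natCast (PowerSeries.C (R :=
      IsLocalRing.ResidueField (Integers K))), ← map_natCast (IsLocalRing.residue (Integers K)),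
      hp', map_zero, zero_mul]
  rw [hright] at hres
  refine subst_ne_zero (f := ℓ.map (IsLocalRing.residue (Integers K)))
    (g := (mulSeries F p).map (IsLocalRing.residue (Integers K))) ?_ hF ?_
    ((PowerSeries.map_subst hsub ℓ).symm.trans hres)
  · intro h0
    have := congrArg (PowerSeries.coeff N) h0
    rw [PowerSeries.coeff_map, map_zero, IsLocalRing.residue_eq_zero_iff,
      mem_maximalIdeal_integers, hℓ, PowerSeries.coeff_mk] at this
    simp only [← hs, inv_mul_cancel₀ hs0, norm_one] at this
    exact lt_irrefl _ this
  · rw [map_mulSeries]; exact constantCoeff_mulSeries _ p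

end Unbounded

/-! ### Uniqueness. -/

section Uniqueness

theorem ev_derivative_rescale {C : Type*} [NormedField C] (b : C) (f : C⟦X⟧) (w : C) :
    ev (PowerSeries.derivative C (PowerSeries.rescale b f)) w =
      b * ev (PowerSeries.derivative C f) (b * w) := by
  rw [ev, ev, ← tsum_mul_left]
  refine tsum_congr fun n => ?_
  rw [PowerSeries.coeff_derivative, PowerSeries.coeff_derivative, PowerSeries.coeff_rescale]
  ring

theorem exists_eq_mul_of_coeff_one {k : Type*} [Field k] {f g : k⟦X⟧}
    (hf0 : PowerSeries.coeff 0 f = 0) (hf1 : PowerSeries.coeff 1 f = 1)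
    (hg0 : PowerSeries.coeff 0 g = 0) (hg1 : PowerSeries.coeff 1 g = 1) :
    ∃ u : k⟦X⟧, PowerSeries.constantCoeff u = 1 ∧ f = g * u := by
  have key : ∀ h : k⟦X⟧, PowerSeries.coeff 0 h = 0 → PowerSeries.coeff 1 h = 1 →
      ∃ h' : k⟦X⟧, PowerSeries.constantCoeff h' = 1 ∧ h = PowerSeries.X * h' := by
    intro h h0 h1
    refine ⟨PowerSeries.mk fun n => PowerSeries.coeff (n + 1) h, ?_, ?_⟩
    · simpa [← PowerSeries.coeff_zero_eq_constantCoeff_apply] using h1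
    · conv_lhs => rw [PowerSeries.eq_X_mul_shift_add_const h]
      rw [← PowerSeries.coeff_zero_eq_constantCoeff_apply, h0, map_zero, add_zero]
  obtain ⟨f', hf', rfl⟩ := key f hf0 hf1
  obtain ⟨g', hg', rfl⟩ := key g hg0 hg1
  refine ⟨g'⁻¹ * f', by simp [hf', hg'], ?_⟩
  rw [mul_assoc, ← mul_assoc g', PowerSeries.mul_inv_cancel g' (by simp [hg']), one_mul]

universe u

variable {K : Type u} [NontriviallyNormedField K] [IsUltrametricDist K] [CompleteSpace K]

/-- Replace `X` by `aX` with `t < ‖a‖ < 1` in a finite extension: the rescaled series are bounded,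
so `integral_of_same_zeros` applies and gives `‖u_n‖ * t ^ n ≤ 1`. Then let `t` tend to `1`. -/
theorem integral_of_zeroSet_eq {p : ℕ} (hp : ‖(p : K)‖ < 1) (hp0 : (p : K) ≠ 0)
    (hgap : ∃ c : ℝ, c < 1 ∧ ∀ x : K, ‖x‖ < 1 → ‖x‖ ≤ c) {f g u : K⟦X⟧}
    (hf0 : f ≠ 0) (hf : ConvOnDisk f) (hg : ConvOnDisk g)
    (hu : PowerSeries.constantCoeff u = 1) (hfu : f = g * u) (hzero : zeroSet f = zeroSet g)
    (hfs : ∀ z ∈ zeroSet f, IsSimpleZero f z) (hgs : ∀ z ∈ zeroSet g, IsSimpleZero g z) :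
    Integral u := by
  intro n
  refine le_of_forall_mul_pow_le (r := 0) n one_pos fun t ht0 ht ht1 => ?_
  obtain ⟨E, _, _, _, ι, φ, a, hφι, hφ, ⟨c, hc1, hc⟩, hsplit, hta, ha1⟩ :=
    exists_ramified_extension hp hp0 hgap ht1
  have hι : ∀ x, ‖ι x‖ = ‖x‖ := fun x => by
    rw [← hφ, ← norm_toCp, ← hφι]; rfl
  have hφa0 : φ a ≠ 0 := by
    rw [← norm_ne_zero_iff, hφ]; exact (ht.trans hta).ne'
  have hmap : ∀ h : K⟦X⟧, (PowerSeries.rescale a (h.map ι)).map φ =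
      PowerSeries.rescale (φ a) (h.map (toCp K)) := fun h => by
    rw [map_rescale, ← hφι, PowerSeries.map_comp]; rfl
  have hlt : ∀ w : Cp K, ‖w‖ < 1 → ‖φ a * w‖ < 1 := fun w hw => by
    rw [norm_mul, hφ]
    exact mul_lt_one_of_nonneg_of_lt_one_left (norm_nonneg _) ha1 hw.le
  have hev : ∀ h : K⟦X⟧, ∀ w : Cp K, ‖w‖ < 1 →
      (ev ((PowerSeries.rescale a (h.map ι)).map φ) w = 0 ↔ φ a * w ∈ zeroSet h) := by
    intro h w hw
    rw [hmap, ev_rescale, ← eval_eq_ev]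
    exact ⟨fun h0 => ⟨hlt w hw, h0⟩, fun h0 => h0.2⟩
  have hsimple : ∀ h : K⟦X⟧, (∀ z ∈ zeroSet h, IsSimpleZero h z) → ∀ w : Cp K, ‖w‖ < 1 →
      ev ((PowerSeries.rescale a (h.map ι)).map φ) w = 0 →
      ev (PowerSeries.derivative (Cp K) ((PowerSeries.rescale a (h.map ι)).map φ)) w ≠ 0 := by
    intro h hs w hw hw0
    have h1 := (hs _ ((hev h w hw).1 hw0)).2
    rw [eval_eq_ev] at h1
    rw [hmap, ev_derivative_rescale, derivative_map]
    exact mul_ne_zero hφa0 h1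
  obtain ⟨Mf, hMf⟩ := (hf.map hι).exists_bound_rescale ha1
  obtain ⟨Mg, hMg⟩ := (hg.map hι).exists_bound_rescale ha1
  have hne : PowerSeries.rescale a (f.map ι) ≠ 0 := by
    obtain ⟨m, hm⟩ := PowerSeries.exists_coeff_ne_zero_iff_ne_zero.2 hf0
    intro h0
    have := congrArg (PowerSeries.coeff m) h0
    rw [PowerSeries.coeff_rescale, PowerSeries.coeff_map, map_zero] at this
    have ha0 : a ≠ 0 := by rintro rfl; exact hφa0 (map_zero φ)
    exact mul_ne_zero (pow_ne_zero _ ha0) ((map_ne_zero ι).2 hm) this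
  have hint : Integral (PowerSeries.rescale a (u.map ι)) := by
    refine integral_of_same_zeros hφ hc1 hc hsplit hne hMf hMg ?_ ?_ ?_
      (hsimple f hfs) (hsimple g hgs)
    · rw [← PowerSeries.coeff_zero_eq_constantCoeff_apply, PowerSeries.coeff_rescale,
        PowerSeries.coeff_map, PowerSeries.coeff_zero_eq_constantCoeff_apply, hu]
      simp
    · rw [hfu, map_mul, map_mul]
    · intro w hw
      rw [hev f w hw, hev g w hw, hzero]
  have hn := hint n
  rw [PowerSeries.coeff_rescale, PowerSeries.coeff_map, norm_mul, norm_pow, hι] at hn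
  calc ‖PowerSeries.coeff n u‖ * t ^ n ≤ ‖PowerSeries.coeff n u‖ * ‖a‖ ^ n := by gcongr
    _ = ‖a‖ ^ n * ‖PowerSeries.coeff n u‖ := mul_comm _ _
    _ ≤ 1 := hn

/-- If `g * h` is bounded on the unit disk and `h` has bounded coefficients, then so does `g`. -/
theorem exists_bound_of_mul_bound {p : ℕ} (hp : ‖(p : K)‖ < 1) (hp0 : (p : K) ≠ 0)
    (hgap : ∃ c : ℝ, c < 1 ∧ ∀ x : K, ‖x‖ < 1 → ‖x‖ ≤ c) {g h : K⟦X⟧} (hg : ConvOnDisk g)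
    (hh : ConvOnDisk h) (hh0 : h ≠ 0) {B : ℝ} (hhB : ∀ n, ‖PowerSeries.coeff n h‖ ≤ B) {M : ℝ}
    (hM : ∀ z : Cp K, ‖z‖ < 1 → ‖ev ((g * h).map (toCp K)) z‖ ≤ M) :
    ∃ M' : ℝ, ∀ n, ‖PowerSeries.coeff n g‖ ≤ M' := by
  obtain ⟨c, hc1, hc⟩ := id hgap
  obtain ⟨s, d, r, hs0, -, hr1, hsd⟩ := exists_norm_ev_eq norm_toCp hc1 hc hh0 hhB
  have hs : 0 < ‖s‖ := norm_pos_iff.2 hs0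
  -- Staying beyond radius `1 / 2` bounds `‖z‖ ^ d` below by `2⁻ᵈ`, so dividing by `h` costs only a
  -- constant.
  have hρ : max r (1 / 2) < 1 := max_lt hr1 (by norm_num)
  refine ⟨M * 2 ^ d / ‖s‖, norm_coeff_le_of_norm_ev_le hp hp0 hgap hg hρ fun z hz hz1 => ?_⟩
  have h1 := hM z hz1
  rw [map_mul, ev_mul (hg.map norm_toCp) (hh.map norm_toCp) hz1, norm_mul,
    hsd z ((le_max_left _ _).trans_lt hz) hz1] at h1
  have h2 : 1 ≤ (‖z‖ * 2) ^ d :=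
    one_le_pow₀ (by linarith [(le_max_right r (1 / 2)).trans_lt hz])
  rw [le_div_iff₀ hs]
  calc ‖ev (g.map (toCp K)) z‖ * ‖s‖
      ≤ ‖ev (g.map (toCp K)) z‖ * ‖s‖ * (‖z‖ * 2) ^ d :=
        le_mul_of_one_le_right (by positivity) h2
    _ = ‖ev (g.map (toCp K)) z‖ * (‖s‖ * ‖z‖ ^ d) * 2 ^ d := by rw [mul_pow]; ring
    _ ≤ M * 2 ^ d := by gcongr

theorem eq_log_of_properties [CharZero K] {p : ℕ} [Fact p.Prime] (hp : ‖(p : K)‖ < 1) (hp0 : (p : K) ≠ 0)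
    (hgap : ∃ c : ℝ, c < 1 ∧ ∀ x : K, ‖x‖ < 1 → ‖x‖ ≤ c) {F : FormalGroup (Integers K)}
    (hF : FiniteHeight p F) {f : K⟦X⟧} (hf0 : PowerSeries.coeff 0 f = 0)
    (hf1 : PowerSeries.coeff 1 f = 1) (hf : ConvOnDisk f) (hzero : zeroSet f = Tors F)
    (hfs : ∀ z ∈ Tors F, IsSimpleZero f z) (hfb : BoundedOnDisk (PowerSeries.derivative K f)) :
    f = Log F := by
  have hL := convOnDisk_log F hp hp0
  obtain ⟨u, hu, hfu⟩ := exists_eq_mul_of_coeff_one hf0 hf1 (coeff_zero_log F) (coeff_one_log F)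
  have hint : Integral u := by
    refine integral_of_zeroSet_eq hp hp0 hgap ?_ hf hL hu hfu
      (hzero.trans (zeroSet_log F hp hp0).symm) (fun z hz => hfs z (hzero ▸ hz))
      fun z hz => isSimpleZero_log F hz
    rintro rfl
    simp at hf1
  obtain ⟨M, hM⟩ := hfb
  have hder : PowerSeries.derivative K f =
      Log F * PowerSeries.derivative K u + u * PowerSeries.derivative K (Log F) := by
    rw [hfu, Derivation.leibniz, smul_eq_mul, smul_eq_mul]
  -- Otherwise `Log · u' = f' - u · Log'` is bounded on the disk, and dividing by the nonzero
  -- bounded series `u'` would bound the coefficients of `Log`.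
  have hu' : PowerSeries.derivative K u = 0 := by
    by_contra hne
    have hintd : Integral (u * PowerSeries.derivative K (Log F)) :=
      hint.mul (by rw [derivative_log]; exact integral_map_algebraMap _)
    have hB : ∀ z : Cp K, ‖z‖ < 1 →
        ‖ev ((Log F * PowerSeries.derivative K u).map (toCp K)) z‖ ≤ max M 1 := by
      intro z hz
      have h1 : ev ((PowerSeries.derivative K f).map (toCp K)) z =
          ev ((Log F * PowerSeries.derivative K u).map (toCp K)) z +
            ev ((u * PowerSeries.derivative K (Log F)).map (toCp K)) z := by
        rw [hder, map_add, ev_add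
          ((hL.mul hint.convOnDisk.derivative).map norm_toCp)
          (hintd.convOnDisk.map norm_toCp) hz]
      rw [eq_sub_of_add_eq h1.symm, sub_eq_add_neg]
      refine (IsUltrametricDist.norm_add_le_max _ _).trans (max_le_max ?_ ?_)
      · rw [← eval_eq_ev]; exact hM z hz
      · rw [norm_neg]
        exact norm_ev_le_of_coeff_le (hintd.map norm_toCp) hz.le
    have hud : ∀ n, ‖PowerSeries.coeff n (PowerSeries.derivative K u)‖ ≤ 1 := fun n => by
      rw [PowerSeries.coeff_derivative, norm_mul, ← Nat.cast_succ]
      exact mul_le_one₀ (hint _) (norm_nonneg _) (IsUltrametricDist.norm_natCast_le_one K _)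
    obtain ⟨M', hM'⟩ := exists_bound_of_mul_bound hp hp0 hgap hL hint.convOnDisk.derivative hne
      hud hB
    exact not_bounded_log hp hgap hF hM'
  have hu1 : u = 1 := PowerSeries.derivative.ext (R := K) (by rw [hu']; simp) (by rw [hu]; simp)
  rw [hfu, hu1, mul_one]

end Uniqueness

end FGLog

theorem mainTheorem5 (p : ℕ) [Fact p.Prime] (k : Type*) [Field k] [CharP k p] [PerfectRing k p]
    (K : Type*) [NontriviallyNormedField K] [IsUltrametricDist K] [CompleteSpace K]
    [Algebra (FractionRing (WittVector p k)) K]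
    [FiniteDimensional (FractionRing (WittVector p k)) K]
    (hp : ‖(p : K)‖ < 1)
    (hW : ∀ x : WittVector p k, ‖algebraMap (FractionRing (WittVector p k)) K
      (algebraMap (WittVector p k) (FractionRing (WittVector p k)) x)‖ ≤ 1)
    (F : FormalGroup (FGLog.Integers K)) (hF : FGLog.FiniteHeight p F) (f : PowerSeries K) :
    (PowerSeries.coeff 0 f = 0 ∧ PowerSeries.coeff 1 f = 1 ∧
      FGLog.HolomorphicOnDisk f ∧
      FGLog.zeroSet f = FGLog.Tors F ∧
      (∀ z ∈ FGLog.Tors F, FGLog.IsSimpleZero f z) ∧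
      FGLog.BoundedOnDisk (PowerSeries.derivative K f)) ↔
    f = FGLog.Log F := by
  have hp0 : (p : K) ≠ 0 := FGLog.natCast_prime_ne_zero_of_witt p k K
  -- The Witt vector structure enters only through `p ≠ 0` in `K` and this discreteness of the norm.
  have hgap : ∃ c : ℝ, c < 1 ∧ ∀ x : K, ‖x‖ < 1 → ‖x‖ ≤ c := FGLog.exists_gap_of_witt hp hW
  have : CharZero K := FGLog.charZero_of_norm_lt_one hp hp0
  constructor
  · rintro ⟨h0, h1, hf, hzero, hfs, hfb⟩
    exact FGLog.eq_log_of_properties hp hp0 hgap hF h0 h1 (hf.convOnDisk hp hp0 hgap) hzero hfs hfb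
  · rintro rfl
    exact ⟨FGLog.coeff_zero_log F, FGLog.coeff_one_log F,
      (FGLog.convOnDisk_log F hp hp0).holomorphicOnDisk, FGLog.zeroSet_log F hp hp0,
      fun z hz => FGLog.isSimpleZero_log F (by rwa [FGLog.zeroSet_log F hp hp0]),
      FGLog.boundedOnDisk_derivative_log F⟩
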